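/- Let $(M,g)$ be a Lie-Hermitian manifold: $M$ is a compact quotient of a Lie group $G$ by (left translations by) a discrete subgroup $\Gamma\subseteq G$, equipped with a complex structure $J$ and a $J$-compatible Riemannian metric $g$ whose lifts to $G$ are left-invariant. Let $\mathfrak g$ be the Lie algebra of $G$, with the complex structure $J$ induced on it, and let $\mathfrak g'=[\mathfrak g,\mathfrak g]$ be its commutator. The Chern connection $\nabla$ of $(M,J,g)$ is the connection on $TM$ with $\nabla g=0$, $\nabla J=0$ whose torsion $T(x,y)=\nabla_xy-\nabla_yx-[x,y]$ satisfies $T(Jx,Jy)=-T(x,y)$; its curvature is $R(x,y,z,w)=\langle\nabla_x\nabla_yz-\nabla_y\nabla_xz-\nabla_{[x,y]}z,w\rangle$, and its holomorphic sectional curvature is $H(x)=R(x,Jx,Jx,x)/|x|^4$ for $x\neq0$. (1) Assume that $\mathfrak g$ is solvable and $J\mathfrak g'=\mathfrak g'$. If the Chern connection of $g$ has constant holomorphic sectional curvature $H=c$, then $g$ is Chern flat, that is, $R=0$; moreover $c=0$ if $\dim M>0$. (2) More generally, let $\mathfrak g$ be a finite-dimensional real solvable Lie algebra, not necessarily unimodular,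 with a linear map $J$ satisfying $J^2=-1$ and $[x,y]-[Jx,Jy]+J[Jx,y]+J[x,Jy]=0$ for all $x,y\in\mathfrak g$, and an inner product with $\langle Jx,Jy\rangle=\langle x,y\rangle$. Let $\nabla:\mathfrak g\times\mathfrak g\to\mathfrak g$ be its Chern connection, that is, the bilinear map with $\langle\nabla_xy,z\rangle+\langle y,\nabla_xz\rangle=0$, $\nabla_xJy=J\nabla_xy$ and $T(Jx,Jy)=-T(x,y)$, where $T$, $R$ and $H$ are given by the formulas above. If $J\mathfrak g'=\mathfrak g'$ and $H=c$ is constant, then $R=0$, and $c=0$ if $\mathfrak g\neq0$. -/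

import Mathlib

open Bundle Manifold
open scoped ContDiff

noncomputable section

/-- Real smooth Lie groups are smooth enough for Mathlib's Lie bracket on `GroupLieAlgebra`. -/
instance instLEInftyMinSmoothnessThree : ENat.LEInfty (minSmoothness ℝ 3) where
  out := by
    rw [minSmoothness_of_isRCLikeNormedField]
    exact WithTop.coe_le_coe.2 (le_top : (3 : ℕ∞) ≤ ⊤)

/-! ### Hermitian manifolds, the Chern connection and its curvature -/

section Manifold

variable {E : Type*} [NormedAddCommGroup E] [NormedSpace ℝ E]
  {M : Type*} [TopologicalSpace M] [ChartedSpace E M]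

/-- A field of endomorphisms of the tangent spaces. -/
abbrev EndField (E : Type*) [NormedAddCommGroup E] [NormedSpace ℝ E]
    (M : Type*) [TopologicalSpace M] [ChartedSpace E M] : Type _ :=
  Π x : M, TangentSpace 𝓘(ℝ, E) x →L[ℝ] TangentSpace 𝓘(ℝ, E) x

/-- The vector field `J X`. -/
def applyField (J : EndField E M) (X : Π x : M, TangentSpace 𝓘(ℝ, E) x) :
    Π x : M, TangentSpace 𝓘(ℝ, E) x :=
  fun x ↦ J x (X x)

variable [IsManifold 𝓘(ℝ, E) ∞ M]

/-- The vector field `X` is differentiable at the point `p`. -/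
def DiffFieldAt (X : Π x : M, TangentSpace 𝓘(ℝ, E) x) (p : M) : Prop :=
  MDifferentiableAt 𝓘(ℝ, E) (𝓘(ℝ, E).prod 𝓘(ℝ, E))
    (fun x ↦ (TotalSpace.mk' E x (X x) : TangentBundle 𝓘(ℝ, E) M)) p

/-- The vector field `X` is twice continuously differentiable near the point `p`. -/
def C2FieldAt (X : Π x : M, TangentSpace 𝓘(ℝ, E) x) (p : M) : Prop :=
  ContMDiffAt 𝓘(ℝ, E) (𝓘(ℝ, E).prod 𝓘(ℝ, E)) 2
    (fun x ↦ (TotalSpace.mk' E x (X x) : TangentBundle 𝓘(ℝ, E) M)) p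

/-- `J` is a complex structure: a smooth field of endomorphisms with `J² = -1` and
`[X, Y] - [JX, JY] + J[JX, Y] + J[X, JY] = 0` for all vector fields `X`, `Y`. -/
structure IsComplexStructure (J : EndField E M) : Prop where
  smooth : ContMDiff 𝓘(ℝ, E) (𝓘(ℝ, E).prod 𝓘(ℝ, E →L[ℝ] E)) ∞
    (fun x ↦ TotalSpace.mk' (E →L[ℝ] E)
      (E := fun x : M ↦ TangentSpace 𝓘(ℝ, E) x →L[ℝ] TangentSpace 𝓘(ℝ, E) x) x (J x))
  sq : ∀ (p : M) (v : TangentSpace 𝓘(ℝ, E) p), J p (J p v) = -v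
  integrable : ∀ (p : M) (X Y : Π x : M, TangentSpace 𝓘(ℝ, E) x),
    DiffFieldAt X p → DiffFieldAt Y p →
      VectorField.mlieBracket 𝓘(ℝ, E) X Y p
        - VectorField.mlieBracket 𝓘(ℝ, E) (applyField J X) (applyField J Y) p
        + J p (VectorField.mlieBracket 𝓘(ℝ, E) (applyField J X) Y p)
        + J p (VectorField.mlieBracket 𝓘(ℝ, E) X (applyField J Y) p) = 0

/-- The Riemannian metric of `M` is Hermitian with respect to `J`. -/
def IsHermitianMetric [RiemannianBundle (fun x : M ↦ TangentSpace 𝓘(ℝ, E) x)]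
    (J : EndField E M) : Prop :=
  ∀ (p : M) (v w : TangentSpace 𝓘(ℝ, E) p), inner ℝ (J p v) (J p w) = inner ℝ v w

/-- `cov` is the Chern connection of the Hermitian manifold `M` with complex structure `J`: the
connection on the tangent bundle that preserves the metric and `J` and whose torsion `T` has no
`(1,1)` part, i.e. `T(Jv, Jw) = -T(v, w)`, equivalently `T(e, f̄) = 0` for `e`, `f` of type
`(1,0)`. Recall that `cov Y p v` is `∇_v Y` at `p`. These conditions determine `∇ Y` at
each point where `Y` is differentiable. -/
structure IsChernConnection [FiniteDimensional ℝ E]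
    [RiemannianBundle (fun x : M ↦ TangentSpace 𝓘(ℝ, E) x)] (J : EndField E M)
    (cov : CovariantDerivative 𝓘(ℝ, E) E (TangentSpace 𝓘(ℝ, E) : M → Type _)) : Prop where
  metric : ∀ (p : M) (Y Z : Π x : M, TangentSpace 𝓘(ℝ, E) x) (v : TangentSpace 𝓘(ℝ, E) p),
    DiffFieldAt Y p → DiffFieldAt Z p →
      mvfderiv 𝓘(ℝ, E) (fun x ↦ inner ℝ (Y x) (Z x)) p v
        = inner ℝ (cov Y p v) (Z p) + inner ℝ (Y p) (cov Z p v)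
  complex : ∀ (p : M) (Y : Π x : M, TangentSpace 𝓘(ℝ, E) x) (v : TangentSpace 𝓘(ℝ, E) p),
    DiffFieldAt Y p → cov (applyField J Y) p v = J p (cov Y p v)
  torsion : ∀ (p : M) (v w : TangentSpace 𝓘(ℝ, E) p),
    haveI : CompleteSpace E := FiniteDimensional.complete ℝ E
    cov.torsion p (J p v) (J p w) = -cov.torsion p v w

/-- The curvature `R(X, Y)Z = ∇_X ∇_Y Z - ∇_Y ∇_X Z - ∇_[X, Y] Z` of a connection. -/
def connectionCurvature
    (cov : CovariantDerivative 𝓘(ℝ, E) E (TangentSpace 𝓘(ℝ, E) : M → Type _))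
    (X Y Z : Π x : M, TangentSpace 𝓘(ℝ, E) x) (p : M) : TangentSpace 𝓘(ℝ, E) p :=
  cov (fun x ↦ cov Z x (Y x)) p (X p) - cov (fun x ↦ cov Z x (X x)) p (Y p)
    - cov Z p (VectorField.mlieBracket 𝓘(ℝ, E) X Y p)

/-- The holomorphic sectional curvature of `cov` is the constant `c`:
`R(X, JX, JX, X) = c |X|⁴`, where `R(X, Y, Z, W) = ⟨R(X, Y)Z, W⟩`. For the Chern connection `R` is
a tensor, so it does not matter how a tangent vector is extended to a vector field. -/
def HasConstantHolSecCurvature [RiemannianBundle (fun x : M ↦ TangentSpace 𝓘(ℝ, E) x)]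
    (J : EndField E M)
    (cov : CovariantDerivative 𝓘(ℝ, E) E (TangentSpace 𝓘(ℝ, E) : M → Type _)) (c : ℝ) : Prop :=
  ∀ (p : M) (X : Π x : M, TangentSpace 𝓘(ℝ, E) x), C2FieldAt X p →
    inner ℝ (connectionCurvature cov X (applyField J X) (applyField J X) p) (X p)
      = c * (inner ℝ (X p) (X p)) ^ 2

/-- The connection is flat: its curvature tensor vanishes identically. -/
def IsFlatConnection
    (cov : CovariantDerivative 𝓘(ℝ, E) E (TangentSpace 𝓘(ℝ, E) : M → Type _)) : Prop :=
  ∀ (p : M) (X Y Z : Π x : M, TangentSpace 𝓘(ℝ, E) x),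
    C2FieldAt X p → C2FieldAt Y p → C2FieldAt Z p → connectionCurvature cov X Y Z p = 0

/-! ### Quotients of Lie groups and left-invariant structures -/

variable {G : Type*} [TopologicalSpace G] [ChartedSpace E G] [Group G]

/-- `q : G → M` exhibits the manifold `M` as the quotient of `G` by the action of the discrete
subgroup `Γ` by left translations. -/
structure IsDiscreteQuotientMap (Γ : Subgroup G) (q : G → M) : Prop where
  discrete : DiscreteTopology Γ
  localDiffeo : IsLocalDiffeomorph 𝓘(ℝ, E) 𝓘(ℝ, E) ∞ q
  surjective : Function.Surjective q
  fibre : ∀ a b : G, q a = q b ↔ ∃ γ ∈ Γ, γ * a = b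

/-- The lift of a field of endomorphisms along a local diffeomorphism. -/
def liftEnd (q : G → M) (J : EndField E M) : EndField E G :=
  fun a ↦ (mfderiv 𝓘(ℝ, E) 𝓘(ℝ, E) q a).inverse ∘L J (q a) ∘L mfderiv 𝓘(ℝ, E) 𝓘(ℝ, E) q a

/-- The lift of the Riemannian metric of `M` along `q`. -/
def liftMetric [RiemannianBundle (fun x : M ↦ TangentSpace 𝓘(ℝ, E) x)] (q : G → M)
    (a : G) (v w : TangentSpace 𝓘(ℝ, E) a) : ℝ :=
  inner ℝ (mfderiv 𝓘(ℝ, E) 𝓘(ℝ, E) q a v : TangentSpace 𝓘(ℝ, E) (q a))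
    (mfderiv 𝓘(ℝ, E) 𝓘(ℝ, E) q a w : TangentSpace 𝓘(ℝ, E) (q a))

/-- A field of endomorphisms on `G` invariant under all left translations. -/
def IsLeftInvariantEnd (A : EndField E G) : Prop :=
  ∀ (a b : G) (v : TangentSpace 𝓘(ℝ, E) b),
    A (a * b) (mfderiv 𝓘(ℝ, E) 𝓘(ℝ, E) (a * ·) b v)
      = mfderiv 𝓘(ℝ, E) 𝓘(ℝ, E) (a * ·) b (A b v)

/-- A family of forms on the tangent spaces of `G` invariant under all left translations. -/
def IsLeftInvariantForm
    (B : Π a : G, TangentSpace 𝓘(ℝ, E) a → TangentSpace 𝓘(ℝ, E) a → ℝ) : Prop :=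
  ∀ (a b : G) (v w : TangentSpace 𝓘(ℝ, E) b),
    B (a * b) (mfderiv 𝓘(ℝ, E) 𝓘(ℝ, E) (a * ·) b v) (mfderiv 𝓘(ℝ, E) 𝓘(ℝ, E) (a * ·) b w)
      = B b v w

end Manifold

/-- The commutator `[𝔤, 𝔤]` (the span of all brackets) is invariant under `J`: `J[𝔤, 𝔤] = [𝔤, 𝔤]`. -/
def HasComplexCommutator {𝔤 : Type*} [LieRing 𝔤] [LieAlgebra ℝ 𝔤] (J : 𝔤 →ₗ[ℝ] 𝔤) : Prop :=
  Submodule.map J (⁅(⊤ : LieIdeal ℝ 𝔤), (⊤ : LieIdeal ℝ 𝔤)⁆ : LieIdeal ℝ 𝔤).toSubmodule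
    = (⁅(⊤ : LieIdeal ℝ 𝔤), (⊤ : LieIdeal ℝ 𝔤)⁆ : LieIdeal ℝ 𝔤).toSubmodule

/-! ### Hermitian Lie algebras -/

section LieAlgebra

variable {𝔤 : Type*} [LieRing 𝔤] [LieAlgebra ℝ 𝔤]

/-- A Hermitian structure on a real Lie algebra: a complex structure `J` and a compatible inner
product `metric`. -/
structure HermitianStructure (𝔤 : Type*) [LieRing 𝔤] [LieAlgebra ℝ 𝔤] where
  /-- The complex structure. -/
  J : 𝔤 →ₗ[ℝ] 𝔤
  /-- The inner product. -/
  metric : 𝔤 →ₗ[ℝ] 𝔤 →ₗ[ℝ] ℝ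
  J_sq : ∀ x, J (J x) = -x
  integrable : ∀ x y, ⁅x, y⁆ - ⁅J x, J y⁆ + J ⁅J x, y⁆ + J ⁅x, J y⁆ = 0
  symm : ∀ x y, metric x y = metric y x
  pos : ∀ x, x ≠ 0 → 0 < metric x x
  compatible : ∀ x y, metric (J x) (J y) = metric x y

/-- A left-invariant connection `(x, y) ↦ ∇_x y` on left-invariant vector fields is the
Chern connection: it preserves the metric and `J`, and its torsion
`T(x, y) = ∇_x y - ∇_y x - [x, y]` satisfies `T(Jx, Jy) = -T(x, y)`. -/
structure HermitianStructure.IsChern (h : HermitianStructure 𝔤)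
    (D : 𝔤 →ₗ[ℝ] 𝔤 →ₗ[ℝ] 𝔤) : Prop where
  metric : ∀ x y z, h.metric (D x y) z + h.metric y (D x z) = 0
  complex : ∀ x y, D x (h.J y) = h.J (D x y)
  torsion : ∀ x y, D (h.J x) (h.J y) - D (h.J y) (h.J x) - ⁅h.J x, h.J y⁆
    = -(D x y - D y x - ⁅x, y⁆)

/-- The curvature `R(x, y)z = ∇_x ∇_y z - ∇_y ∇_x z - ∇_[x, y] z`. -/
def algCurvature (D : 𝔤 →ₗ[ℝ] 𝔤 →ₗ[ℝ] 𝔤) (x y z : 𝔤) : 𝔤 :=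
  D x (D y z) - D y (D x z) - D ⁅x, y⁆ z

/-- The holomorphic sectional curvature of `D` is the constant `c`. -/
def HermitianStructure.HasConstantHolSec (h : HermitianStructure 𝔤)
    (D : 𝔤 →ₗ[ℝ] 𝔤 →ₗ[ℝ] 𝔤) (c : ℝ) : Prop :=
  ∀ x, h.metric (algCurvature D x (h.J x) (h.J x)) x = c * (h.metric x x) ^ 2

end LieAlgebra

end

/-!
The heart of the matter is a statement about a solvable Lie algebra `𝔤` with complex structure
`J`, compatible inner product and Chern connection `∇`, with `[𝔤, 𝔤]` invariant under `J`. Split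
`∇_y = A_y + B_y` into its `(1,0)` and `(0,1)` parts. The torsion condition gives
`B_y x = ½ ([y, x] + J [J y, x])`, which lies in `[𝔤, 𝔤]`. Up to the factor `½`, this is the
action of the subalgebra `𝔤^{0,1}` of the complexification of `𝔤` on the quotient by `𝔤^{0,1}`,
which is `(𝔤, J)`. Compatibility with the metric says that `A_y` is minus the adjoint of `B_y`.

Since `𝔤^{0,1}` is solvable, Lie's theorem provides common eigenvectors `x` of all `B_y`, inside
each nonzero invariant complex subspace (`exists_antihol_eigenvector`). Commutators of a solvable
Lie algebra act nilpotently, so the eigenvalue of `B_y` on `x` is zero if `y ∈ [𝔤, 𝔤]`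
(`antihol_eigenvalue_eq_zero`); here `J [𝔤, 𝔤] = [𝔤, 𝔤]` is needed, for `y + i J y` to be a
commutator. It follows that `B_x x = 0`. The curvature is
`⟨R(x, Jx)Jx, x⟩ = 2 (|A_x x|² - |B_x x|² - 2 ⟨x, B_{B_x x} x⟩)`, which is nonnegative for an
eigenvector `x` and nonpositive for `x` orthogonal to `[𝔤, 𝔤]`, so the constant is `0`
(`HermitianStructure.IsChern.holSec_eq_zero`).

Next, for an eigenvector `x`, the second-order part of `H(x + t y) = 0`, summed over `y` in an
orthonormal basis, says `∑ (|A_y x|² - |B_y x|²) = 0`. But `A_y x` has a component of length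
`|B_y x|` along the complex line of `x`, so it has no other component: `x` is an eigenvector of
`∇` as well, with imaginary eigenvalues (`HermitianStructure.IsChern.exists_eq_smul_J`). The
operators `∇_y` commute on `x`, and `∇_[y,z] x = 0`, so `R(y, z) x = 0`. Finally the eigenvectors
span `𝔤`, because the orthogonal complement of their span is again invariant under `B`
(`HermitianStructure.IsChern.flat_of_holSec_eq_zero`).

For a quotient `M` of a Lie group, the left-invariant vector fields project locally to frames of
`M` with constant inner products and structure constants (`isHermitianFrame_sectionFrame`). On
such a frame the Chern connection of `M` is the Chern connection of the Lie algebra of the group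
(`IsHermitianFrame.exists_isChern`), and its curvature is the algebraic one. That the curvature
then vanishes on all vector fields follows from its being tensorial and skew
(`IsHermitianFrame.connectionCurvature_eq_zero`).
-/

noncomputable section

/-! ### Weights of solvable Lie algebras -/

section LieTheorem

variable {k : Type*} [Field k] [CharZero k] [IsAlgClosed k]
  {L : Type*} [LieRing L] [LieAlgebra k L] [LieAlgebra.IsSolvable L]

/-- In characteristic zero, a commutator element of a solvable Lie algebra acts nilpotently on
every finite-dimensional module. A maximal submodule on which it is locally nilpotent is
everything: by Lie's theorem a nonzero quotient contains a weight vector, and its weight kills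
commutators, so the submodule could be enlarged. -/
lemma isNilpotent_toEnd_of_mem_derived {V : Type*} [AddCommGroup V] [Module k V]
    [FiniteDimensional k V] [LieRingModule L V] [LieModule k L V] {y : L}
    (hy : y ∈ ⁅(⊤ : LieIdeal k L), (⊤ : LieIdeal k L)⁆) :
    IsNilpotent (LieModule.toEnd k L V y) := by
  let P : LieSubmodule k L V → Prop := fun U ↦
    ∀ v ∈ U, ∃ n : ℕ, ((LieModule.toEnd k L V y) ^ n) v = 0
  obtain ⟨U, hU, hmax⟩ : ∃ U, P U ∧ ∀ U', P U' → ¬ U < U' := by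
    have hwf : WellFounded ((· > ·) : LieSubmodule k L V → LieSubmodule k L V → Prop) :=
      LieSubmodule.wellFoundedGT_of_noetherian k L V |>.wf
    obtain ⟨U, hU, h⟩ := hwf.has_min {U | P U} ⟨⊥, by
      intro v hv
      exact ⟨0, by simpa using hv⟩⟩
    exact ⟨U, hU, fun U' h' ↦ h U' h'⟩
  have htop : U = ⊤ := by
    by_contra hne
    have : Nontrivial (V ⧸ U) := by
      rw [← not_subsingleton_iff_nontrivial]
      intro hs
      apply hne
      have := (Submodule.Quotient.subsingleton_iff (p := U.toSubmodule)).1 hs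
      simpa using this
    obtain ⟨χ, hχ⟩ := LieModule.exists_nontrivial_weightSpace_of_isSolvable k L (V ⧸ U)
    obtain ⟨⟨w, hw⟩, hw0⟩ := exists_ne (0 : LieModule.weightSpace (V ⧸ U) χ)
    have hw0 : w ≠ 0 := fun h ↦ hw0 (Subtype.ext h)
    rw [LieModule.mem_weightSpace] at hw
    -- a weight, being a character, kills commutators
    have hχ : ∀ z ∈ ⁅(⊤ : LieIdeal k L), (⊤ : LieIdeal k L)⁆, χ z = 0 := by
      intro z hz
      have : (⁅(⊤ : LieIdeal k L), (⊤ : LieIdeal k L)⁆ : LieIdeal k L).toSubmodule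
          ≤ LinearMap.ker χ := by
        rw [LieSubmodule.lieIdeal_oper_eq_linear_span', Submodule.span_le]
        rintro _ ⟨a, -, b, -, rfl⟩
        have h1 : ⁅⁅a, b⁆, w⁆ = 0 := by
          rw [lie_lie, hw b, hw a, lie_smul, lie_smul, hw a, hw b, smul_smul, smul_smul, mul_comm,
            sub_self]
        rw [hw] at h1
        simpa [hw0] using h1
      exact this hz
    obtain ⟨v, rfl⟩ := Submodule.Quotient.mk_surjective _ w
    have hv : ∀ z, ⁅z, v⁆ - χ z • v ∈ U := by
      intro z
      have := hw z
      rw [← sub_eq_zero] at this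
      exact (Submodule.Quotient.mk_eq_zero U.toSubmodule).1 this
    have hvU : v ∉ U := fun h ↦ hw0 ((Submodule.Quotient.mk_eq_zero U.toSubmodule).2 h)
    let U' : LieSubmodule k L V :=
      { U.toSubmodule ⊔ Submodule.span k {v} with
        lie_mem := by
          intro z m hm
          obtain ⟨u, hu, s, hs, rfl⟩ := Submodule.mem_sup.1 hm
          obtain ⟨c, rfl⟩ := Submodule.mem_span_singleton.1 hs
          have h2 := hv z
          rw [show ⁅z, u + c • v⁆ = (⁅z, u⁆ + c • (⁅z, v⁆ - χ z • v)) + (c * χ z) • v by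
            rw [lie_add, lie_smul]; module]
          exact Submodule.add_mem_sup (U.add_mem (U.lie_mem hu) (U.smul_mem _ h2))
            (Submodule.smul_mem _ _ (Submodule.mem_span_singleton_self v)) }
    refine hmax U' ?_ ?_
    · intro m hm
      obtain ⟨u, hu, s, hs, rfl⟩ := Submodule.mem_sup.1 hm
      obtain ⟨c, rfl⟩ := Submodule.mem_span_singleton.1 hs
      have h2 := hv y
      rw [hχ y hy, zero_smul, sub_zero] at h2
      obtain ⟨n, hn⟩ := hU _ (U.add_mem (U.lie_mem (x := y) hu) (U.smul_mem c h2))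
      refine ⟨n + 1, ?_⟩
      rw [pow_succ, Module.End.mul_apply]
      simpa using hn
    · refine lt_of_le_of_ne (fun u hu ↦ Submodule.mem_sup_left hu) ?_
      rintro h
      apply hvU
      rw [h]
      exact Submodule.mem_sup_right (Submodule.mem_span_singleton_self v)
  refine Module.End.isNilpotent_iff_of_finite.2 fun v ↦ hU v (htop ▸ LieSubmodule.mem_top v)

variable [FiniteDimensional k L]

/-- Lie's theorem for the action of a subalgebra `Q` on a `Q`-stable piece `(W + Q) / Q` of
`L / Q`. -/
lemma exists_lie_eq_smul_mod_subalgebra (Q : LieSubalgebra k L) (W : Submodule k L)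
    (hW : ∃ w ∈ W, w ∉ Q) (hQ : ∀ q ∈ Q, ∀ w ∈ W, ⁅q, w⁆ ∈ W) :
    ∃ w ∈ W, w ∉ Q ∧ ∀ q ∈ Q, ∃ a : k, ⁅q, w⁆ - a • w ∈ Q := by
  let W' : LieSubmodule k Q L := { W with lie_mem := fun {q m} hm ↦ hQ q q.2 m hm }
  let N : LieSubmodule k Q W' := Q.toLieSubmodule.comap W'.incl
  have hN : ∀ w : W', w ∈ N ↔ (w : L) ∈ Q := by
    intro w
    simp [N]
  have : Nontrivial (W' ⧸ N) := by
    obtain ⟨w, hw, hwQ⟩ := hW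
    refine ⟨⟨(Submodule.Quotient.mk (⟨w, hw⟩ : W') : W' ⧸ N.toSubmodule), 0, ?_⟩⟩
    intro h
    exact hwQ ((hN ⟨w, hw⟩).1 ((Submodule.Quotient.mk_eq_zero N.toSubmodule).1 h))
  have : LieAlgebra.IsSolvable Q :=
    Function.Injective.lieAlgebra_isSolvable (f := Q.incl) Subtype.val_injective
  obtain ⟨χ, hχ⟩ := LieModule.exists_nontrivial_weightSpace_of_isSolvable k Q (W' ⧸ N)
  obtain ⟨⟨w, hw⟩, hw0⟩ := exists_ne (0 : LieModule.weightSpace (W' ⧸ N) χ)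
  have hw0 : w ≠ 0 := fun h ↦ hw0 (Subtype.ext h)
  rw [LieModule.mem_weightSpace] at hw
  obtain ⟨v, rfl⟩ := Submodule.Quotient.mk_surjective _ w
  refine ⟨v, v.2, fun h ↦ hw0 ((Submodule.Quotient.mk_eq_zero N.toSubmodule).2 ((hN v).2 h)), ?_⟩
  intro q hq
  refine ⟨χ ⟨q, hq⟩, ?_⟩
  have := hw ⟨q, hq⟩
  rw [← sub_eq_zero] at this
  exact (hN (⁅(⟨q, hq⟩ : Q), v⁆ - χ ⟨q, hq⟩ • v)).1
    ((Submodule.Quotient.mk_eq_zero N.toSubmodule).1 this)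

/-- The weights of a subalgebra `Q` on `L / Q` vanish on the elements of `Q` that are commutators
in `L`, since these are ad-nilpotent. -/
lemma eq_zero_of_lie_sub_smul_mem_subalgebra (Q : LieSubalgebra k L) {q w : L} {a : k}
    (hq : q ∈ Q) (hw : w ∉ Q) (h : ⁅q, w⁆ - a • w ∈ Q)
    (hder : q ∈ ⁅(⊤ : LieIdeal k L), (⊤ : LieIdeal k L)⁆) : a = 0 := by
  obtain ⟨n, hn⟩ := isNilpotent_toEnd_of_mem_derived (k := k) (V := L) hder
  -- modulo `Q`, the nilpotent operator `ad q` has the eigenvalue `a` on `w`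
  have key : ∀ m : ℕ, ((LieModule.toEnd k L L q) ^ m) w - a ^ m • w ∈ Q := by
    intro m
    induction m with
    | zero => simp
    | succ m ih =>
      have h1 := Q.add_mem (Q.lie_mem hq ih) (Q.smul_mem (a ^ m) h)
      convert h1 using 1
      rw [pow_succ', Module.End.mul_apply, LieModule.toEnd_apply_apply, lie_sub, lie_smul]
      module
  have h1 := key n
  rw [hn] at h1
  have h2 : a ^ n • w ∈ Q := by simpa using h1
  by_contra ha
  apply hw
  have := Q.smul_mem (a ^ n)⁻¹ h2
  rwa [smul_smul, inv_mul_cancel₀ (pow_ne_zero _ ha), one_smul] at this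

end LieTheorem

/-! ### The action of the antiholomorphic subalgebra -/

section ComplexStructure

open scoped TensorProduct

variable {𝔤 : Type*} [LieRing 𝔤] [LieAlgebra ℝ 𝔤]

/-- The projection of the complexification of `𝔤` onto `𝔤^{1,0}` along `𝔤^{0,1}`, where `𝔤^{1,0}`
is identified with the complex vector space `(𝔤, J)`: `z ⊗ x` is sent to `z • x`, with `I` acting
as `J`. -/
def holProj (J : 𝔤 →ₗ[ℝ] 𝔤) : ℂ ⊗[ℝ] 𝔤 →ₗ[ℝ] 𝔤 :=
  TensorProduct.lift
    ((LinearMap.toSpanSingleton ℝ (𝔤 →ₗ[ℝ] 𝔤) LinearMap.id) ∘ₗ Complex.reLm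
      + (LinearMap.toSpanSingleton ℝ (𝔤 →ₗ[ℝ] 𝔤) J) ∘ₗ Complex.imLm)

lemma holProj_tmul (J : 𝔤 →ₗ[ℝ] 𝔤) (z : ℂ) (x : 𝔤) :
    holProj J (z ⊗ₜ x) = z.re • x + z.im • J x := by
  simp [holProj]

/-- The projection onto `(𝔤, J)` is complex linear. -/
lemma holProj_smul {J : 𝔤 →ₗ[ℝ] 𝔤} (hJ : ∀ x, J (J x) = -x) (z : ℂ) (u : ℂ ⊗[ℝ] 𝔤) :
    holProj J (z • u) = z.re • holProj J u + z.im • J (holProj J u) := by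
  induction u with
  | zero => simp
  | add a b ha hb => rw [smul_add, map_add, ha, hb, map_add, map_add]; module
  | tmul w x =>
    rw [TensorProduct.smul_tmul', holProj_tmul, holProj_tmul, map_add, map_smul, map_smul, hJ]
    simp only [smul_eq_mul, Complex.mul_re, Complex.mul_im]
    module

lemma exists_tmul_add_I_tmul (u : ℂ ⊗[ℝ] 𝔤) :
    ∃ x y : 𝔤, u = (1 : ℂ) ⊗ₜ x + Complex.I ⊗ₜ y := by
  induction u with
  | zero => exact ⟨0, 0, by simp⟩
  | add a b ha hb =>
    obtain ⟨x, y, rfl⟩ := ha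
    obtain ⟨x', y', rfl⟩ := hb
    exact ⟨x + x', y + y', by rw [TensorProduct.tmul_add, TensorProduct.tmul_add]; abel⟩
  | tmul z x =>
    refine ⟨z.re • x, z.im • x, ?_⟩
    rw [TensorProduct.tmul_smul, TensorProduct.tmul_smul, TensorProduct.smul_tmul',
      TensorProduct.smul_tmul', ← TensorProduct.add_tmul]
    congr 1
    apply Complex.ext <;> simp

/-- The vector `y + i J y` of type `(0,1)`, which is twice the `(0,1)` part of `y`. -/
def antiholVec (J : 𝔤 →ₗ[ℝ] 𝔤) (y : 𝔤) : ℂ ⊗[ℝ] 𝔤 := (1 : ℂ) ⊗ₜ y + Complex.I ⊗ₜ J y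

lemma holProj_eq_zero_iff {J : 𝔤 →ₗ[ℝ] 𝔤} (hJ : ∀ x, J (J x) = -x) (u : ℂ ⊗[ℝ] 𝔤) :
    holProj J u = 0 ↔ ∃ y, u = antiholVec J y := by
  constructor
  · intro h
    obtain ⟨x, y, rfl⟩ := exists_tmul_add_I_tmul u
    rw [map_add, holProj_tmul, holProj_tmul] at h
    have hx : x = -J y := by
      rw [eq_neg_iff_add_eq_zero]
      simpa using h
    refine ⟨x, ?_⟩
    rw [antiholVec, hx, map_neg, hJ, neg_neg]
  · rintro ⟨y, rfl⟩
    simp [antiholVec, holProj_tmul, hJ]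

/-- The action of `𝔤^{0,1}` on the quotient of the complexification by `𝔤^{0,1}`, read in
`(𝔤, J)`: the vector `y + i J y` acts by `x ↦ [y, x] + J [J y, x]`. -/
lemma holProj_lie_antiholVec {J : 𝔤 →ₗ[ℝ] 𝔤} (hJ : ∀ x, J (J x) = -x)
    (hint : ∀ x y, ⁅x, y⁆ - ⁅J x, J y⁆ + J ⁅J x, y⁆ + J ⁅x, J y⁆ = 0)
    (y : 𝔤) (u : ℂ ⊗[ℝ] 𝔤) :
    holProj J ⁅antiholVec J y, u⁆ = ⁅y, holProj J u⁆ + J ⁅J y, holProj J u⁆ := by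
  obtain ⟨a, b, rfl⟩ := exists_tmul_add_I_tmul u
  have h' := congrArg J (hint y b)
  simp only [map_add, map_sub, hJ, map_zero] at h'
  simp only [antiholVec, lie_add, add_lie, LieAlgebra.ExtendScalars.bracket_tmul, map_add,
    holProj_tmul, Complex.I_mul_I, mul_one, one_mul, Complex.one_re, Complex.one_im, Complex.I_re,
    Complex.I_im, Complex.neg_re, Complex.neg_im, one_smul, zero_smul, add_zero, zero_add, neg_smul,
    neg_zero]
  rw [← sub_eq_zero, ← h']
  abel

/-- The subalgebra `𝔤^{0,1}` of the complexification, the kernel of the projection to `(𝔤, J)`; it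
is closed under brackets because `J` is integrable. -/
def antiholSubalgebra (J : 𝔤 →ₗ[ℝ] 𝔤) (hJ : ∀ x, J (J x) = -x)
    (hint : ∀ x y, ⁅x, y⁆ - ⁅J x, J y⁆ + J ⁅J x, y⁆ + J ⁅x, J y⁆ = 0) :
    LieSubalgebra ℂ (ℂ ⊗[ℝ] 𝔤) where
  carrier := {u | holProj J u = 0}
  add_mem' := fun {a b} (ha : holProj J a = 0) (hb : holProj J b = 0) ↦ by
    simp [ha, hb]
  zero_mem' := by simp
  smul_mem' := fun z u (hu : holProj J u = 0) ↦ by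
    simp [holProj_smul hJ, hu]
  lie_mem' := fun {a b} (ha : holProj J a = 0) (hb : holProj J b = 0) ↦ by
    obtain ⟨y, rfl⟩ := (holProj_eq_zero_iff hJ a).1 ha
    simp [holProj_lie_antiholVec hJ hint, hb]

/-- A nonzero `J`-invariant subspace that is stable under all operators `x ↦ [y, x] + J [J y, x]`
contains a common complex eigenvector of them, a complex scalar `a + b i` acting as `a + b J`. -/
lemma exists_antihol_eigenvector [FiniteDimensional ℝ 𝔤] [LieAlgebra.IsSolvable 𝔤]
    {J : 𝔤 →ₗ[ℝ] 𝔤} (hJ : ∀ x, J (J x) = -x)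
    (hint : ∀ x y, ⁅x, y⁆ - ⁅J x, J y⁆ + J ⁅J x, y⁆ + J ⁅x, J y⁆ = 0)
    {W : Submodule ℝ 𝔤} (hW : W ≠ ⊥) (hWJ : ∀ x ∈ W, J x ∈ W)
    (hWB : ∀ y, ∀ x ∈ W, ⁅y, x⁆ + J ⁅J y, x⁆ ∈ W) :
    ∃ x ∈ W, x ≠ 0 ∧ ∀ y, ∃ a b : ℝ, ⁅y, x⁆ + J ⁅J y, x⁆ = a • x + b • J x := by
  let Q := antiholSubalgebra J hJ hint
  have hQ : ∀ u, u ∈ Q ↔ holProj J u = 0 := fun u ↦ Iff.rfl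
  let W' : Submodule ℂ (ℂ ⊗[ℝ] 𝔤) :=
    { carrier := {u | holProj J u ∈ W}
      add_mem' := fun {a b} (ha : holProj J a ∈ W) (hb : holProj J b ∈ W) ↦ by
        simpa using W.add_mem ha hb
      zero_mem' := by simp
      smul_mem' := fun z u (hu : holProj J u ∈ W) ↦ by
        change holProj J (z • u) ∈ W
        rw [holProj_smul hJ]
        exact W.add_mem (W.smul_mem _ hu) (W.smul_mem _ (hWJ _ hu)) }
  obtain ⟨x₀, hx₀, hx₀'⟩ := W.ne_bot_iff.1 hW
  obtain ⟨w, hw, hwQ, h⟩ := exists_lie_eq_smul_mod_subalgebra Q W'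
    ⟨(1 : ℂ) ⊗ₜ x₀, by
      change holProj J _ ∈ W
      simpa [holProj_tmul] using hx₀, by
      rw [hQ]
      simpa [holProj_tmul] using hx₀'⟩
    (by
      intro q hq u hu
      obtain ⟨y, rfl⟩ := (holProj_eq_zero_iff hJ q).1 hq
      change holProj J _ ∈ W
      rw [holProj_lie_antiholVec hJ hint]
      exact hWB _ _ hu)
  refine ⟨holProj J w, hw, hwQ, fun y ↦ ?_⟩
  obtain ⟨a, ha⟩ := h (antiholVec J y) ((holProj_eq_zero_iff hJ _).2 ⟨y, rfl⟩)
  rw [hQ, map_sub, holProj_lie_antiholVec hJ hint, holProj_smul hJ, sub_eq_zero] at ha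
  exact ⟨a.re, a.im, ha⟩

/-- On a common eigenvector, the eigenvalue of `x ↦ [y, x] + J [J y, x]` is zero if `y` and `J y`
are in the commutator. -/
lemma antihol_eigenvalue_eq_zero [FiniteDimensional ℝ 𝔤] [LieAlgebra.IsSolvable 𝔤]
    {J : 𝔤 →ₗ[ℝ] 𝔤} (hJ : ∀ x, J (J x) = -x)
    (hint : ∀ x y, ⁅x, y⁆ - ⁅J x, J y⁆ + J ⁅J x, y⁆ + J ⁅x, J y⁆ = 0)
    {x y : 𝔤} (hx : x ≠ 0) (hy : y ∈ ⁅(⊤ : LieIdeal ℝ 𝔤), (⊤ : LieIdeal ℝ 𝔤)⁆)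
    (hJy : J y ∈ ⁅(⊤ : LieIdeal ℝ 𝔤), (⊤ : LieIdeal ℝ 𝔤)⁆) {a b : ℝ}
    (h : ⁅y, x⁆ + J ⁅J y, x⁆ = a • x + b • J x) : a = 0 ∧ b = 0 := by
  have hder : antiholVec J y ∈
      ⁅(⊤ : LieIdeal ℂ (ℂ ⊗[ℝ] 𝔤)), (⊤ : LieIdeal ℂ (ℂ ⊗[ℝ] 𝔤))⁆ := by
    rw [← LieSubmodule.baseChange_top (R := ℝ) (A := ℂ) (L := 𝔤) (M := 𝔤),
      ← LieSubmodule.lie_baseChange]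
    exact add_mem (LieSubmodule.tmul_mem_baseChange_of_mem _ hy)
      (LieSubmodule.tmul_mem_baseChange_of_mem _ hJy)
  have hQ : ∀ u, u ∈ antiholSubalgebra J hJ hint ↔ holProj J u = 0 := fun u ↦ Iff.rfl
  have h0 := eq_zero_of_lie_sub_smul_mem_subalgebra (antiholSubalgebra J hJ hint)
    (q := antiholVec J y) (w := (1 : ℂ) ⊗ₜ x) (a := ⟨a, b⟩)
    ((holProj_eq_zero_iff hJ _).2 ⟨y, rfl⟩) (by rw [hQ]; simpa [holProj_tmul] using hx)
    (by
      rw [hQ, map_sub, holProj_lie_antiholVec hJ hint, holProj_smul hJ]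
      simp [holProj_tmul, h]) hder
  exact ⟨congrArg Complex.re h0, congrArg Complex.im h0⟩

end ComplexStructure

/-! ### Hermitian Lie algebras and the two parts of the Chern connection -/

namespace HermitianStructure

variable {𝔤 : Type*} [LieRing 𝔤] [LieAlgebra ℝ 𝔤] (h : HermitianStructure 𝔤)

lemma metric_J_left (x y : 𝔤) : h.metric (h.J x) y = -h.metric x (h.J y) := by
  have := h.compatible x (h.J y)
  rw [h.J_sq, map_neg] at this
  linarith

lemma metric_self_J (x : 𝔤) : h.metric x (h.J x) = 0 := by
  have := h.metric_J_left x x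
  rw [h.symm] at this
  linarith

lemma metric_nonneg (x : 𝔤) : 0 ≤ h.metric x x := by
  rcases eq_or_ne x 0 with rfl | hx
  · simp
  · exact (h.pos x hx).le

lemma metric_self_eq_zero {x : 𝔤} : h.metric x x = 0 ↔ x = 0 :=
  ⟨fun hx ↦ by_contra fun hne ↦ (h.pos x hne).ne' hx, by rintro rfl; simp⟩

lemma ext_metric {x y : 𝔤} (hxy : ∀ z, h.metric x z = h.metric y z) : x = y := by
  rw [← sub_eq_zero, ← h.metric_self_eq_zero]
  simp [hxy]

/-- There is an orthonormal basis. It is stated for the bilinear form `h.metric`, so that no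
normed space structure on `𝔤` intervenes. -/
lemma exists_orthonormal [FiniteDimensional ℝ 𝔤] :
    ∃ (n : ℕ) (e : Fin n → 𝔤), (∀ i j, h.metric (e i) (e j) = if i = j then 1 else 0) ∧
      ∀ x, x = ∑ i, h.metric x (e i) • e i := by
  let core : InnerProductSpace.Core ℝ 𝔤 :=
    { inner := fun x y ↦ h.metric x y
      conj_inner_symm := fun x y ↦ h.symm y x
      re_inner_nonneg := fun x ↦ h.metric_nonneg x
      add_left := fun x y z ↦ by simp
      smul_left := fun x y r ↦ by simp
      definite := fun x hx ↦ h.metric_self_eq_zero.1 hx }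
  let _ : NormedAddCommGroup 𝔤 := core.toNormedAddCommGroup
  let _ : InnerProductSpace ℝ 𝔤 := InnerProductSpace.ofCore core.toCore
  let b := stdOrthonormalBasis ℝ 𝔤
  refine ⟨_, b, fun i j ↦ ?_, fun x ↦ ?_⟩
  · exact orthonormal_iff_ite.1 b.orthonormal i j
  · conv_lhs => rw [← b.sum_repr x]
    refine Finset.sum_congr rfl fun i _ ↦ ?_
    rw [b.repr_apply_apply]
    exact congrArg (· • b i) (h.symm (b i) x)

/-- The commutator `[𝔤, 𝔤]`. -/
abbrev derived (𝔤 : Type*) [LieRing 𝔤] [LieAlgebra ℝ 𝔤] : LieIdeal ℝ 𝔤 :=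
  ⁅(⊤ : LieIdeal ℝ 𝔤), (⊤ : LieIdeal ℝ 𝔤)⁆

lemma lie_mem_derived (x y : 𝔤) : ⁅x, y⁆ ∈ derived 𝔤 :=
  LieSubmodule.lie_mem_lie (LieSubmodule.mem_top _) (LieSubmodule.mem_top _)

lemma _root_.HasComplexCommutator.map_mem {J : 𝔤 →ₗ[ℝ] 𝔤} (hJ : HasComplexCommutator J) {x : 𝔤}
    (hx : x ∈ derived 𝔤) : J x ∈ derived 𝔤 := by
  have h1 : J x ∈ Submodule.map J (derived 𝔤).toSubmodule := Submodule.mem_map_of_mem hx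
  rw [hJ] at h1
  exact h1

/-- The `(0,1)` part `y ↦ ½ (∇_y + J ∇_{J y})` of the Chern connection, written through brackets,
`½ ([y, x] + J [J y, x])`: it depends only on `J` and not on the metric. -/
def antihol : 𝔤 →ₗ[ℝ] 𝔤 →ₗ[ℝ] 𝔤 :=
  (2⁻¹ : ℝ) • ((LieModule.toEnd ℝ 𝔤 𝔤 : 𝔤 →ₗ[ℝ] 𝔤 →ₗ[ℝ] 𝔤)
    + ((LieModule.toEnd ℝ 𝔤 𝔤 : 𝔤 →ₗ[ℝ] 𝔤 →ₗ[ℝ] 𝔤) ∘ₗ h.J).compr₂ h.J)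

lemma antihol_apply (y x : 𝔤) : h.antihol y x = (2⁻¹ : ℝ) • (⁅y, x⁆ + h.J ⁅h.J y, x⁆) := by
  simp [antihol]

lemma antihol_J_left (y x : 𝔤) : h.antihol (h.J y) x = -h.J (h.antihol y x) := by
  simp only [antihol_apply, h.J_sq, map_smul, map_add, neg_lie, map_neg]
  module

/-- Integrability of `J` says that the operators `h.antihol y` are complex linear. -/
lemma antihol_J_right (y x : 𝔤) : h.antihol y (h.J x) = h.J (h.antihol y x) := by
  have h' := congrArg h.J (h.integrable y x)
  simp only [map_add, map_sub, h.J_sq, map_zero] at h'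
  simp only [antihol_apply, h.J_sq, map_smul, map_add]
  rw [← sub_eq_zero, ← smul_sub]
  have : ⁅y, h.J x⁆ + h.J ⁅h.J y, h.J x⁆ - (h.J ⁅y, x⁆ + -⁅h.J y, x⁆) =
    -(h.J ⁅y, x⁆ - h.J ⁅h.J y, h.J x⁆ + -⁅h.J y, x⁆ + -⁅y, h.J x⁆) := by abel
  rw [this, h', neg_zero, smul_zero]

lemma antihol_mem_derived (hJ : HasComplexCommutator h.J) (y x : 𝔤) :
    h.antihol y x ∈ derived 𝔤 := by
  rw [antihol_apply]
  exact (derived 𝔤).smul_mem _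
    ((derived 𝔤).add_mem (lie_mem_derived _ _) (hJ.map_mem (lie_mem_derived _ _)))

lemma lie_self_J (x : 𝔤) : ⁅x, h.J x⁆ = (2 : ℝ) • h.J (h.antihol x x) := by
  rw [antihol_apply, lie_self, zero_add, map_smul, h.J_sq, smul_smul, ← lie_skew (h.J x) x]
  simp

namespace IsChern

variable {h} {D : 𝔤 →ₗ[ℝ] 𝔤 →ₗ[ℝ] 𝔤}

/-- The torsion condition identifies the `(0,1)` part of the Chern connection with the operator
defined through brackets. -/
lemma antihol_eq (hD : h.IsChern D) (y x : 𝔤) :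
    h.antihol y x = (2⁻¹ : ℝ) • (D y x + h.J (D (h.J y) x)) := by
  have key : ∀ a b, h.J (D (h.J a) b - D b (h.J a) - ⁅h.J a, b⁆) = -(D a b - D b a - ⁅a, b⁆) := by
    intro a b
    have h1 := hD.torsion a b
    have h2 := hD.torsion a (h.J b)
    have hi := h.integrable a b
    simp only [h.J_sq, map_neg, lie_neg, hD.complex, LinearMap.neg_apply] at h1 h2
    have h2' := congrArg h.J h2
    simp only [map_sub, map_neg, h.J_sq] at h2'
    simp only [map_sub, hD.complex, h.J_sq]
    linear_combination (norm := module) (2⁻¹ : ℝ) • h1 - (2⁻¹ : ℝ) • h2' - (2⁻¹ : ℝ) • hi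
  have := key y x
  simp only [map_sub, hD.complex, h.J_sq] at this
  rw [antihol_apply]
  congr 1
  rw [← sub_eq_zero] at this ⊢
  rw [← neg_eq_zero, ← this]
  abel

/-- The `(1,0)` part `y ↦ ½ (∇_y - J ∇_{J y})` of the connection `D`. -/
def hol (h : HermitianStructure 𝔤) (D : 𝔤 →ₗ[ℝ] 𝔤 →ₗ[ℝ] 𝔤) : 𝔤 →ₗ[ℝ] 𝔤 →ₗ[ℝ] 𝔤 := D - h.antihol

lemma hol_add_antihol (y x : 𝔤) : hol h D y x + h.antihol y x = D y x := by
  simp [hol]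

lemma hol_eq (hD : h.IsChern D) (y x : 𝔤) :
    hol h D y x = (2⁻¹ : ℝ) • (D y x - h.J (D (h.J y) x)) := by
  simp only [hol, LinearMap.sub_apply, hD.antihol_eq]
  module

lemma hol_J_left (hD : h.IsChern D) (y x : 𝔤) : hol h D (h.J y) x = h.J (hol h D y x) := by
  simp only [hD.hol_eq, h.J_sq, map_smul, map_sub, LinearMap.neg_apply, map_neg]
  module

lemma hol_J_right (hD : h.IsChern D) (y x : 𝔤) : hol h D y (h.J x) = h.J (hol h D y x) := by
  simp only [hD.hol_eq, hD.complex, map_smul, map_sub]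

/-- The two parts of a metric connection are, up to sign, adjoint to each other. -/
lemma metric_hol_left (hD : h.IsChern D) (y x z : 𝔤) :
    h.metric (hol h D y x) z = -h.metric x (h.antihol y z) := by
  have h1 := hD.metric y x z
  have h2 := hD.metric (h.J y) x (h.J z)
  rw [hD.complex] at h2
  rw [hD.hol_eq, hD.antihol_eq]
  simp only [map_smul, map_sub, map_add, LinearMap.smul_apply, LinearMap.sub_apply,
    h.metric_J_left, smul_eq_mul]
  linarith

lemma metric_antihol_left (hD : h.IsChern D) (y x z : 𝔤) :
    h.metric (h.antihol y x) z = -h.metric x (hol h D y z) := by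
  rw [h.symm, h.symm x, hD.metric_hol_left, neg_neg]

/-- The Chern connection is unique: its `(0,1)` part is given by brackets, and its `(1,0)` part is
minus the adjoint of that. -/
lemma unique (hD : h.IsChern D) {D' : 𝔤 →ₗ[ℝ] 𝔤 →ₗ[ℝ] 𝔤} (hD' : h.IsChern D') : D = D' := by
  ext y x
  apply h.ext_metric
  intro z
  rw [← hol_add_antihol (h := h), ← hol_add_antihol (h := h) (D := D')]
  simp [hD.metric_hol_left, hD'.metric_hol_left]

/-- The holomorphic sectional curvature through `A = hol h D` and `B = h.antihol`:
`⟨R(x, Jx)Jx, x⟩ = 2 (|A_x x|² - |B_x x|² - 2 ⟨x, B_{B_x x} x⟩)`. -/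
lemma metric_curvature_self (hD : h.IsChern D) (x : 𝔤) :
    h.metric (algCurvature D x (h.J x) (h.J x)) x =
      2 * (h.metric (hol h D x x) (hol h D x x) - h.metric (h.antihol x x) (h.antihol x x)
        - 2 * h.metric x (h.antihol (h.antihol x x) x)) := by
  have e : algCurvature D x (h.J x) (h.J x) =
      (2 : ℝ) • (hol h D x (h.antihol x x) - h.antihol x (hol h D x x)
        + hol h D (h.antihol x x) x - h.antihol (h.antihol x x) x) := by
    simp only [algCurvature, h.lie_self_J, ← hol_add_antihol (h := h) (D := D)]
    simp only [map_add, map_smul, hD.hol_J_left, hD.hol_J_right, h.antihol_J_left,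
      h.antihol_J_right, LinearMap.smul_apply, h.J_sq, map_neg]
    module
  rw [e]
  have m1 := hD.metric_hol_left x (h.antihol x x) x
  have m2 := hD.metric_antihol_left x (hol h D x x) x
  have m3 := hD.metric_hol_left (h.antihol x x) x x
  have m4 := h.symm (h.antihol (h.antihol x x) x) x
  simp only [map_add, map_sub, map_smul, LinearMap.add_apply, LinearMap.sub_apply,
    LinearMap.smul_apply, smul_eq_mul]
  linarith

end IsChern

end HermitianStructure

/-! ### Constant holomorphic sectional curvature on solvable Lie algebras -/

namespace HermitianStructure

variable {𝔤 : Type*} [LieRing 𝔤] [LieAlgebra ℝ 𝔤] (h : HermitianStructure 𝔤)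

/-- The trace identity `tr (f g) = tr (g f)`, traces being taken in an orthonormal basis. -/
lemma sum_metric_comp_comm {n : ℕ} {e : Fin n → 𝔤}
    (he : ∀ x, x = ∑ i, h.metric x (e i) • e i) (f g : 𝔤 →ₗ[ℝ] 𝔤) :
    ∑ i, h.metric (f (g (e i))) (e i) = ∑ i, h.metric (g (f (e i))) (e i) := by
  have key : ∀ f g : 𝔤 →ₗ[ℝ] 𝔤, ∑ i, h.metric (f (g (e i))) (e i)
      = ∑ i, ∑ j, h.metric (g (e i)) (e j) * h.metric (f (e j)) (e i) := by
    intro f g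
    refine Finset.sum_congr rfl fun i _ ↦ ?_
    conv_lhs => rw [he (g (e i))]
    simp
  rw [key f g, key g f, Finset.sum_comm]
  refine Finset.sum_congr rfl fun i _ ↦ Finset.sum_congr rfl fun j _ ↦ mul_comm _ _

/-- A proper subspace has a nonzero vector orthogonal to it. -/
lemma exists_ne_zero_metric_eq_zero [FiniteDimensional ℝ 𝔤] {S : Submodule ℝ 𝔤} (hS : S < ⊤) :
    ∃ x, x ≠ 0 ∧ ∀ s ∈ S, h.metric x s = 0 := by
  obtain ⟨f, hf, hfS⟩ := Submodule.exists_le_ker_of_lt_top S hS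
  obtain ⟨n, e, -, he⟩ := h.exists_orthonormal
  have hx : ∀ z, h.metric (∑ i, f (e i) • e i) z = f z := by
    intro z
    conv_rhs => rw [he z]
    simp only [map_sum, map_smul, LinearMap.sum_apply, LinearMap.smul_apply, smul_eq_mul]
    exact Finset.sum_congr rfl fun i _ ↦ by rw [h.symm z, mul_comm]
  refine ⟨∑ i, f (e i) • e i, ?_, fun s hs ↦ by rw [hx]; exact hfS hs⟩
  intro h0
  apply hf
  ext z
  rw [← hx, h0]
  simp

/-- `x` is a common complex eigenvector of all operators `h.antihol y`; the complex scalar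
`a + b i` acts as `a + b J`. The vector `0` is allowed. -/
def IsAntiholEigenvector (x : 𝔤) : Prop := ∀ y, ∃ a b : ℝ, h.antihol y x = a • x + b • h.J x

namespace IsAntiholEigenvector

variable {h} {x : 𝔤} [FiniteDimensional ℝ 𝔤] [LieAlgebra.IsSolvable 𝔤]

lemma antihol_eq_zero_of_mem (hx : h.IsAntiholEigenvector x) (hJ : HasComplexCommutator h.J) {y : 𝔤}
    (hy : y ∈ derived 𝔤) : h.antihol y x = 0 := by
  rcases eq_or_ne x 0 with rfl | hx0
  · simp
  obtain ⟨a, b, hab⟩ := hx y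
  have h1 : ⁅y, x⁆ + h.J ⁅h.J y, x⁆ = (2 * a) • x + (2 * b) • h.J x := by
    rw [mul_smul, mul_smul, ← smul_add, ← hab, antihol_apply, smul_smul]
    norm_num
  obtain ⟨ha, hb⟩ := antihol_eigenvalue_eq_zero h.J_sq h.integrable hx0 hy (hJ.map_mem hy) h1
  have ha : a = 0 := by linarith
  have hb : b = 0 := by linarith
  rw [hab, ha, hb, zero_smul, zero_smul, add_zero]

/-- An eigenvector satisfies `B_x x = 0`: if the eigenvalue of `B_x` on `x` were nonzero, then `x`
would be a multiple of `B_x x`, hence a commutator, and eigenvalues vanish on commutators. -/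
lemma antihol_self (hx : h.IsAntiholEigenvector x) (hJ : HasComplexCommutator h.J) :
    h.antihol x x = 0 := by
  obtain ⟨a, b, hab⟩ := hx x
  have hmem := h.antihol_mem_derived hJ x x
  by_cases h0 : a ^ 2 + b ^ 2 = 0
  · have ha : a = 0 := by nlinarith [sq_nonneg a, sq_nonneg b]
    have hb : b = 0 := by nlinarith [sq_nonneg a, sq_nonneg b]
    rw [hab, ha, hb, zero_smul, zero_smul, add_zero]
  · -- `(a - bJ)(a + bJ) = a² + b²`, so `x` lies in the commutator
    apply hx.antihol_eq_zero_of_mem hJ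
    have h1 : (a ^ 2 + b ^ 2) • x = a • h.antihol x x - b • h.J (h.antihol x x) := by
      rw [hab, map_add, map_smul, map_smul, h.J_sq]
      module
    have h2 : (a ^ 2 + b ^ 2) • x ∈ derived 𝔤 := by
      rw [h1]
      exact sub_mem ((derived 𝔤).smul_mem _ hmem) ((derived 𝔤).smul_mem _ (hJ.map_mem hmem))
    have h3 := (derived 𝔤).smul_mem (a ^ 2 + b ^ 2)⁻¹ h2
    rwa [smul_smul, inv_mul_cancel₀ h0, one_smul] at h3

end IsAntiholEigenvector

lemma exists_isAntiholEigenvector [FiniteDimensional ℝ 𝔤] [LieAlgebra.IsSolvable 𝔤]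
    {W : Submodule ℝ 𝔤} (hW : W ≠ ⊥) (hWJ : ∀ x ∈ W, h.J x ∈ W)
    (hWB : ∀ y, ∀ x ∈ W, h.antihol y x ∈ W) :
    ∃ x ∈ W, x ≠ 0 ∧ h.IsAntiholEigenvector x := by
  have h2 : ∀ y x, ⁅y, x⁆ + h.J ⁅h.J y, x⁆ = (2 : ℝ) • h.antihol y x := by
    intro y x
    rw [antihol_apply, smul_smul]
    norm_num
  obtain ⟨x, hxW, hx0, hx⟩ := exists_antihol_eigenvector h.J_sq h.integrable hW hWJ
    (fun y x hx ↦ by rw [h2]; exact W.smul_mem _ (hWB y x hx))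
  refine ⟨x, hxW, hx0, fun y ↦ ?_⟩
  obtain ⟨a, b, hab⟩ := hx y
  exact ⟨2⁻¹ * a, 2⁻¹ * b, by rw [antihol_apply, hab]; module⟩

namespace IsChern

variable {h} {D : 𝔤 →ₗ[ℝ] 𝔤 →ₗ[ℝ] 𝔤} [FiniteDimensional ℝ 𝔤] [LieAlgebra.IsSolvable 𝔤] {c : ℝ}

/-- The constant is zero. For a nonzero `x` orthogonal to the commutator one has `A_y x = 0` for
all `y` and `⟨x, B_{B_x x} x⟩ = 0`, so `c |x|⁴ = -2 |B_x x|²`; for a nonzero eigenvector `x` one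
has `B_x x = 0`, so `c |x|⁴ = 2 |A_x x|²`. -/
lemma holSec_eq_zero [Nontrivial 𝔤] (hD : h.IsChern D) (hJ : HasComplexCommutator h.J)
    (hc : h.HasConstantHolSec D c) : c = 0 := by
  apply le_antisymm
  -- a vector orthogonal to the commutator, which is proper by solvability, gives `c ≤ 0`
  · have hlt : (derived 𝔤).toSubmodule < ⊤ := by
      rw [lt_top_iff_ne_top]
      have := (LieAlgebra.derivedSeries_lt_top_of_solvable ℝ 𝔤).ne
      intro h1
      exact this ((LieSubmodule.toSubmodule_eq_top (N := derived 𝔤)).1 h1)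
    obtain ⟨x, hx0, hx⟩ := h.exists_ne_zero_metric_eq_zero hlt
    have hA : ∀ y, hol h D y x = 0 := fun y ↦ h.ext_metric fun z ↦ by
      rw [hD.metric_hol_left, hx _ (h.antihol_mem_derived hJ y z)]
      simp
    have h1 := hc x
    rw [hD.metric_curvature_self, hA, hx _ (h.antihol_mem_derived hJ _ x)] at h1
    have h2 := h.metric_nonneg (h.antihol x x)
    have h3 : 0 < (h.metric x x) ^ 2 := pow_pos (h.pos x hx0) 2
    by_contra! hcpos
    have := mul_pos hcpos h3
    simp at h1
    linarith
  -- an eigenvector gives `0 ≤ c`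
  · obtain ⟨x, -, hx0, hx⟩ := h.exists_isAntiholEigenvector (W := ⊤) top_ne_bot (by simp) (by simp)
    have h1 := hc x
    rw [hD.metric_curvature_self, hx.antihol_self hJ] at h1
    have h2 := h.metric_nonneg (hol h D x x)
    have h3 : 0 < (h.metric x x) ^ 2 := pow_pos (h.pos x hx0) 2
    simp at h1
    by_contra! hcneg
    have := mul_neg_of_neg_of_pos hcneg h3
    linarith

variable {x : 𝔤}

lemma hol_self_eq_zero (hD : h.IsChern D) (hJ : HasComplexCommutator h.J)
    (hc : h.HasConstantHolSec D 0) (hx : h.IsAntiholEigenvector x) : hol h D x x = 0 := by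
  have h1 := hc x
  rw [hD.metric_curvature_self, hx.antihol_self hJ] at h1
  apply h.metric_self_eq_zero.1
  simpa using h1

/-- The coefficient of `t²` in `H(x + t y) = 0`, for an eigenvector `x`. It is extracted from
`t = 1` and `t = -1` together with `H(y) = 0`, all odd terms cancelling. -/
lemma polarized_holSec (hD : h.IsChern D) (hJ : HasComplexCommutator h.J)
    (hc : h.HasConstantHolSec D 0) (hx : h.IsAntiholEigenvector x) (y : 𝔤) :
    h.metric (hol h D x y) (hol h D x y) + 2 * h.metric (hol h D x y) (hol h D y x)
      + h.metric (hol h D y x) (hol h D y x)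
      - h.metric (h.antihol x y) (h.antihol x y) - h.metric (h.antihol y x) (h.antihol y x)
      + 2 * h.metric (hol h D (h.antihol x y) x) y = 0 := by
  have hA := hD.hol_self_eq_zero hJ hc hx
  have hB := hx.antihol_self hJ
  have hA' : ∀ a b : ℝ, ∀ z, z = a • x + b • h.J x → hol h D x z = 0 ∧ hol h D z x = 0 := by
    rintro a b z rfl
    simp [hD.hol_J_left, hD.hol_J_right, hA]
  obtain ⟨a, b, hab⟩ := hx y
  obtain ⟨hA1, hA2⟩ := hA' a b _ hab
  -- `B_y x` lies in the complex line of `x`, which `A_x` kills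
  have hcross : h.metric (h.antihol x y) (h.antihol y x) = 0 := by
    rw [hD.metric_antihol_left, hA1]
    simp
  have hmem := h.antihol_mem_derived hJ
  have hB1 := hx.antihol_eq_zero_of_mem hJ (hmem y y)
  have hB2 := hx.antihol_eq_zero_of_mem hJ (hmem x y)
  have hB3 := hx.antihol_eq_zero_of_mem hJ (hmem y x)
  have e3 := hD.metric_hol_left (h.antihol y x) x y
  rw [hA2] at e3
  have e4 := hD.metric_hol_left (h.antihol x y) x y
  have g0 := hc y
  have g1 := hc (x + y)
  have g2 := hc (x - y)
  rw [hD.metric_curvature_self, zero_mul] at g0 g1 g2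
  simp only [map_add, map_sub, LinearMap.add_apply, LinearMap.sub_apply, hA, hB, hB1, hB2, hB3,
    map_zero, LinearMap.zero_apply] at g0 g1 g2 e3
  have s1 := h.symm (hol h D x y) (hol h D y x)
  have s2 := h.symm (h.antihol x y) (h.antihol y x)
  have s3 := h.symm (hol h D x y) (hol h D y y)
  have s4 := h.symm (hol h D y x) (hol h D y y)
  have s5 := h.symm (h.antihol x y) (h.antihol y y)
  have s6 := h.symm (h.antihol y x) (h.antihol y y)
  linarith

omit [FiniteDimensional ℝ 𝔤] [LieAlgebra.IsSolvable 𝔤] in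
/-- On an eigenvector `x` with eigenvalue `a + b i` of `B_y`, the vector `A_y x` has the component
`(-a + b J) x` along the complex line of `x`, of length `|B_y x|`; the left-hand side is the
squared length of the orthogonal remainder. -/
lemma sq_hol_eq (hD : h.IsChern D) {y : 𝔤} {a b : ℝ} (hab : h.antihol y x = a • x + b • h.J x) :
    h.metric (hol h D y x + a • x - b • h.J x) (hol h D y x + a • x - b • h.J x)
      = h.metric (hol h D y x) (hol h D y x) - h.metric (h.antihol y x) (h.antihol y x) := by
  have e1 : h.metric (hol h D y x) x = -(a * h.metric x x) := by
    rw [hD.metric_hol_left, hab]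
    simp [h.metric_self_J]
  have e2 : h.metric (hol h D y x) (h.J x) = b * h.metric x x := by
    rw [hD.metric_hol_left, h.antihol_J_right, hab]
    simp [h.metric_self_J, h.J_sq]
  have s1 := h.symm x (hol h D y x)
  have s2 := h.symm (h.J x) (hol h D y x)
  have s3 := h.symm (h.J x) x
  rw [hab]
  simp only [map_add, map_sub, map_smul, LinearMap.add_apply, LinearMap.sub_apply,
    LinearMap.smul_apply, smul_eq_mul, s1, s2, s3, e1, e2, h.metric_self_J, h.compatible]
  ring

/-- If `c = 0`, an eigenvector of the `(0,1)` part is an eigenvector of the whole connection, with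
imaginary eigenvalues. Summing the polarized curvature identity over an orthonormal basis, all
terms cancel by `tr (f g) = tr (g f)` except `∑ (|A_y x|² - |B_y x|²) = 0`, a sum of squared
lengths. -/
lemma exists_eq_smul_J (hD : h.IsChern D) (hJ : HasComplexCommutator h.J)
    (hc : h.HasConstantHolSec D 0) (hx : h.IsAntiholEigenvector x) (y : 𝔤) :
    ∃ m : ℝ, D y x = m • h.J x := by
  obtain ⟨n, e, -, he⟩ := h.exists_orthonormal
  have hsum : ∑ i, (h.metric (hol h D (e i) x) (hol h D (e i) x)
      - h.metric (h.antihol (e i) x) (h.antihol (e i) x)) = 0 := by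
    -- `tr (A_x B_x) = tr (B_x A_x)` cancels `|A_x y|²` against `|B_x y|²`
    have t1 : ∑ i, -h.metric (h.antihol x (e i)) (h.antihol x (e i))
        = ∑ i, -h.metric (hol h D x (e i)) (hol h D x (e i)) :=
      (Finset.sum_congr rfl fun i _ ↦ (hD.metric_hol_left _ _ _).symm).trans
        ((h.sum_metric_comp_comm he (hol h D x) (h.antihol x)).trans
          (Finset.sum_congr rfl fun i _ ↦ hD.metric_antihol_left _ _ _))
    -- the mixed terms cancel, by the trace identity for `B_x` and `y ↦ A_y x`
    have t2 : ∑ i, -h.metric (hol h D x (e i)) (hol h D (e i) x)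
        = ∑ i, h.metric (hol h D (h.antihol x (e i)) x) (e i) :=
      (Finset.sum_congr rfl fun i _ ↦ by
        rw [h.symm, LinearMap.flip_apply, hD.metric_antihol_left]).trans
        (h.sum_metric_comp_comm he (h.antihol x) ((hol h D).flip x))
    have p := Finset.sum_congr (s₁ := Finset.univ) rfl
      fun i _ ↦ hD.polarized_holSec hJ hc hx (e i)
    simp only [Finset.sum_add_distrib, Finset.sum_sub_distrib, ← Finset.mul_sum,
      Finset.sum_const_zero, Finset.sum_neg_distrib] at p t1 t2 ⊢
    linarith
  have hz := (Finset.sum_eq_zero_iff_of_nonneg (fun i _ ↦ by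
    obtain ⟨a, b, hab⟩ := hx (e i)
    rw [← hD.sq_hol_eq hab]
    exact h.metric_nonneg _)).1 hsum
  have hi : ∀ i, ∃ m : ℝ, D (e i) x = m • h.J x := by
    intro i
    obtain ⟨a, b, hab⟩ := hx (e i)
    have h1 := hz i (Finset.mem_univ i)
    rw [← hD.sq_hol_eq hab, h.metric_self_eq_zero] at h1
    refine ⟨2 * b, ?_⟩
    rw [← hol_add_antihol (h := h), hab]
    linear_combination (norm := module) (1 : ℝ) • h1
  choose m hm using hi
  refine ⟨∑ i, h.metric y (e i) * m i, ?_⟩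
  conv_lhs => rw [he y]
  simp [hm, Finset.sum_smul, mul_smul]

/-- If the holomorphic sectional curvature vanishes, so does the curvature. It vanishes on
eigenvectors. These span `𝔤`: the orthogonal complement of their span is stable under the `(0,1)`
part, so it would contain another eigenvector if it were nonzero. -/
theorem flat_of_holSec_eq_zero (hD : h.IsChern D) (hJ : HasComplexCommutator h.J)
    (hc : h.HasConstantHolSec D 0) (y z w : 𝔤) : algCurvature D y z w = 0 := by
  -- the curvature vanishes on eigenvectors
  have hflat : ∀ x, h.IsAntiholEigenvector x → algCurvature D y z x = 0 := by
    intro x hx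
    obtain ⟨m, hm⟩ := hD.exists_eq_smul_J hJ hc hx y
    obtain ⟨l, hl⟩ := hD.exists_eq_smul_J hJ hc hx z
    obtain ⟨r, hr⟩ := hD.exists_eq_smul_J hJ hc hx ⁅y, z⁆
    -- the `(0,1)` part of `D ⁅y, z⁆ x` is zero, hence so is the inner product with `J x`
    have hr0 : D ⁅y, z⁆ x = 0 := by
      have hB := hx.antihol_eq_zero_of_mem hJ (lie_mem_derived y z)
      have h1 : h.metric (D ⁅y, z⁆ x) (h.J x) = 0 := by
        rw [← hol_add_antihol (h := h), hB, add_zero, hD.metric_hol_left, h.antihol_J_right, hB]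
        simp
      rw [← h.metric_self_eq_zero]
      nth_rw 2 [hr]
      rw [map_smul, h1, smul_zero]
    rw [algCurvature, hr0, hm, hl, map_smul, map_smul, hD.complex, hD.complex, hm, hl]
    simp only [map_smul]
    module
  let S := Submodule.span ℝ {x | h.IsAntiholEigenvector x}
  let W : Submodule ℝ 𝔤 :=
    { carrier := {w | ∀ s ∈ S, h.metric w s = 0}
      add_mem' := fun {a b} ha hb s hs ↦ by simp [ha s hs, hb s hs]
      zero_mem' := fun s _ ↦ by simp
      smul_mem' := fun t a ha s hs ↦ by simp [ha s hs] }
  have hSJ : ∀ x ∈ S, h.J x ∈ S := by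
    intro x hx
    refine Submodule.span_induction (p := fun x _ ↦ h.J x ∈ S) ?_ (by simp)
      (fun a b _ _ ha hb ↦ by simpa using S.add_mem ha hb)
      (fun t a _ ha ↦ by simpa using S.smul_mem t ha) hx
    intro v (hv : h.IsAntiholEigenvector v)
    refine Submodule.subset_span fun u ↦ ?_
    obtain ⟨a, b, hab⟩ := hv u
    exact ⟨a, b, by rw [h.antihol_J_right, hab]; simp⟩
  have hSA : ∀ u, ∀ x ∈ S, hol h D u x ∈ S := by
    intro u x hx
    refine Submodule.span_induction (p := fun x _ ↦ hol h D u x ∈ S) ?_ (by simp)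
      (fun a b _ _ ha hb ↦ by simpa using S.add_mem ha hb)
      (fun t a _ ha ↦ by simpa using S.smul_mem t ha) hx
    intro v (hv : h.IsAntiholEigenvector v)
    have hvS : v ∈ S := Submodule.subset_span hv
    obtain ⟨m, hm⟩ := hD.exists_eq_smul_J hJ hc hv u
    obtain ⟨a, b, hab⟩ := hv u
    have : hol h D u v = m • h.J v - (a • v + b • h.J v) := by
      rw [← hm, ← hab, hol, LinearMap.sub_apply, LinearMap.sub_apply]
    rw [this]
    exact S.sub_mem (S.smul_mem _ (hSJ v hvS))
      (S.add_mem (S.smul_mem _ hvS) (S.smul_mem _ (hSJ v hvS)))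
  -- `W` is the orthogonal complement of the span, and `h.antihol` is minus the adjoint of `hol`
  have hW : W = ⊥ := by
    by_contra hne
    obtain ⟨v, hvW, hv0, hv⟩ := h.exists_isAntiholEigenvector hne
      (fun x hx s hs ↦ by rw [h.metric_J_left, hx _ (hSJ s hs), neg_zero])
      (fun u x hx s hs ↦ by rw [hD.metric_antihol_left, hx _ (hSA u s hs), neg_zero])
    exact hv0 (h.metric_self_eq_zero.1 (hvW v (Submodule.subset_span hv)))
  -- the curvature of a metric connection is skew, so its values are orthogonal to the span
  have hskew : ∀ s, h.metric (algCurvature D y z w) s = -h.metric w (algCurvature D y z s) := by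
    intro s
    have m1 := hD.metric y (D z w) s
    have m2 := hD.metric z (D y w) s
    have m3 := hD.metric z w (D y s)
    have m4 := hD.metric y w (D z s)
    have m5 := hD.metric ⁅y, z⁆ w s
    simp only [algCurvature, map_sub, LinearMap.sub_apply]
    linarith
  have hmem : algCurvature D y z w ∈ W := by
    intro s hs
    rw [hskew]
    have : algCurvature D y z s = 0 := by
      refine Submodule.span_induction (p := fun s _ ↦ algCurvature D y z s = 0) hflat
        (by simp [algCurvature]) (fun a b _ _ ha hb ↦ ?_) (fun t a _ ha ↦ ?_) hs
      · simp only [algCurvature, map_add] at ha hb ⊢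
        linear_combination (norm := module) (1 : ℝ) • ha + (1 : ℝ) • hb
      · simp only [algCurvature, map_smul] at ha ⊢
        rw [← smul_sub, ← smul_sub, ha, smul_zero]
    rw [this, map_zero, neg_zero]
  rw [hW] at hmem
  exact (Submodule.mem_bot ℝ).1 hmem

end IsChern

end HermitianStructure

theorem HermitianStructure.flat_and_holSec_eq_zero {𝔤 : Type*} [LieRing 𝔤] [LieAlgebra ℝ 𝔤]
    [FiniteDimensional ℝ 𝔤] (h : HermitianStructure 𝔤) (D : 𝔤 →ₗ[ℝ] 𝔤 →ₗ[ℝ] 𝔤) (c : ℝ)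
    (hs : LieAlgebra.IsSolvable 𝔤) (hJ : HasComplexCommutator h.J) (hD : h.IsChern D)
    (hc : h.HasConstantHolSec D c) :
    (∀ x y z, algCurvature D x y z = 0) ∧ (Nontrivial 𝔤 → c = 0) := by
  refine ⟨fun x y z ↦ ?_, fun _ ↦ hD.holSec_eq_zero hJ hc⟩
  rcases subsingleton_or_nontrivial 𝔤 with _ | _
  · exact Subsingleton.elim _ _
  · obtain rfl := hD.holSec_eq_zero hJ hc
    exact hD.flat_of_holSec_eq_zero hJ hc x y z

/-! ### Differentiation along vector fields -/

section VectorFields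

variable {E : Type*} [NormedAddCommGroup E] [NormedSpace ℝ E]
  {M : Type*} [TopologicalSpace M] [ChartedSpace E M] [IsManifold 𝓘(ℝ, E) ∞ M]

lemma C2FieldAt.diffFieldAt {X : Π x : M, TangentSpace 𝓘(ℝ, E) x} {p : M} (hX : C2FieldAt X p) :
    DiffFieldAt X p :=
  hX.mdifferentiableAt two_ne_zero

lemma C2FieldAt.eventually {X : Π x : M, TangentSpace 𝓘(ℝ, E) x} {p : M} (hX : C2FieldAt X p) :
    ∀ᶠ x in nhds p, C2FieldAt X x :=
  (contMDiffAt_iff_contMDiffAt_nhds (by simp)).1 hX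

lemma MDifferentiableAt.mvfderiv_apply {f : M → ℝ} {Y : Π x : M, TangentSpace 𝓘(ℝ, E) x} {p : M}
    (hf : ContMDiffAt 𝓘(ℝ, E) 𝓘(ℝ, ℝ) 2 f p) (hY : DiffFieldAt Y p) :
    MDifferentiableAt 𝓘(ℝ, E) 𝓘(ℝ, ℝ) (fun x ↦ mvfderiv 𝓘(ℝ, E) f x (Y x)) p := by
  have h1 := (hf.mfderiv_const (m := 1) (by norm_num)).mdifferentiableAt one_ne_zero
  have h2 : MDifferentiableAt 𝓘(ℝ, E) (𝓘(ℝ, ℝ).prod 𝓘(ℝ, ℝ))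
      (fun x ↦ (⟨f x, mfderiv 𝓘(ℝ, E) 𝓘(ℝ, ℝ) f x (Y x)⟩ : TangentBundle 𝓘(ℝ, ℝ) ℝ)) p :=
    MDifferentiableAt.clm_apply_of_inCoordinates (b₁ := id) (b₂ := f) h1 hY
      (hf.mdifferentiableAt two_ne_zero)
  exact ((contMDiff_snd_tangentBundle_modelSpace ℝ 𝓘(ℝ, ℝ) (n := 1)).contMDiffAt.mdifferentiableAt
    one_ne_zero).comp p h2

variable [FiniteDimensional ℝ E]

/-- `[X, Y] f = X (Y f) - Y (X f)` for the Lie bracket of vector fields. It is obtained by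
comparing the Leibniz identities of `X`, `Y` with `W` and with `f W`, for a field `W` not
vanishing at `p`. -/
lemma mvfderiv_mlieBracket {f : M → ℝ} {X Y : Π x : M, TangentSpace 𝓘(ℝ, E) x} {p : M}
    (hf : ContMDiffAt 𝓘(ℝ, E) 𝓘(ℝ, ℝ) 2 f p) (hX : C2FieldAt X p) (hY : C2FieldAt Y p) :
    mvfderiv 𝓘(ℝ, E) f p (VectorField.mlieBracket 𝓘(ℝ, E) X Y p) =
      mvfderiv 𝓘(ℝ, E) (fun x ↦ mvfderiv 𝓘(ℝ, E) f x (Y x)) p (X p)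
        - mvfderiv 𝓘(ℝ, E) (fun x ↦ mvfderiv 𝓘(ℝ, E) f x (X x)) p (Y p) := by
  have : CompleteSpace E := FiniteDimensional.complete ℝ E
  -- a field `W` with `W p ≠ 0` exists only in positive dimension
  rcases subsingleton_or_nontrivial E with hE | hE
  · have h0 : ∀ v : TangentSpace 𝓘(ℝ, E) p, v = 0 := fun v ↦ @Subsingleton.elim E hE v 0
    rw [h0 (X p), h0 (Y p), h0 (VectorField.mlieBracket 𝓘(ℝ, E) X Y p)]
    simp
  obtain ⟨w, hw⟩ : ∃ w : TangentSpace 𝓘(ℝ, E) p, w ≠ 0 := exists_ne (α := E) 0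
  let W : Π x : M, TangentSpace 𝓘(ℝ, E) x := FiberBundle.extend E w
  have hWp : W p ≠ 0 := by
    simpa [W] using hw
  have hW : C2FieldAt W p := FiberBundle.contMDiffAt_extend _ _ _
  have hfW : C2FieldAt (f • W) p := hf.smul_section hW
  have bracket : ∀ {U V : Π x : M, TangentSpace 𝓘(ℝ, E) x}, C2FieldAt U p → C2FieldAt V p →
      DiffFieldAt (VectorField.mlieBracket 𝓘(ℝ, E) U V) p := by
    intro U V hU hV
    refine ContMDiffAt.mdifferentiableAt (n := 1) ?_ one_ne_zero
    have : IsManifold 𝓘(ℝ, E) (((2 : ℕ∞) : WithTop ℕ∞) + 1) M :=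
      IsManifold.of_le (n := ∞) (by exact_mod_cast le_top)
    exact ContMDiffAt.mlieBracket_vectorField (m := 1) (n := 2) hU hV
      (by rw [minSmoothness_of_isRCLikeNormedField]; norm_num)
  have smulR : ∀ {U V : Π x : M, TangentSpace 𝓘(ℝ, E) x}, C2FieldAt V p →
      VectorField.mlieBracket 𝓘(ℝ, E) U (f • V) =ᶠ[nhds p]
        ((fun x ↦ mvfderiv 𝓘(ℝ, E) f x (U x)) • V + f • VectorField.mlieBracket 𝓘(ℝ, E) U V :
          Π x : M, TangentSpace 𝓘(ℝ, E) x) := by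
    intro U V hV
    filter_upwards [hV.eventually, (contMDiffAt_iff_contMDiffAt_nhds (by simp)).1 hf] with x hx hfx
    exact VectorField.mlieBracket_smul_right (hfx.mdifferentiableAt two_ne_zero) hx.diffFieldAt
  have hfp := hf.mdifferentiableAt two_ne_zero
  have second : ∀ {U V : Π x : M, TangentSpace 𝓘(ℝ, E) x}, C2FieldAt U p → C2FieldAt V p →
      VectorField.mlieBracket 𝓘(ℝ, E) U (VectorField.mlieBracket 𝓘(ℝ, E) V (f • W)) p =
        mvfderiv 𝓘(ℝ, E) (fun x ↦ mvfderiv 𝓘(ℝ, E) f x (V x)) p (U p) • W p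
        + mvfderiv 𝓘(ℝ, E) f p (V p) • VectorField.mlieBracket 𝓘(ℝ, E) U W p
        + mvfderiv 𝓘(ℝ, E) f p (U p) • VectorField.mlieBracket 𝓘(ℝ, E) V W p
        + f p • VectorField.mlieBracket 𝓘(ℝ, E) U (VectorField.mlieBracket 𝓘(ℝ, E) V W) p := by
    intro U V hU hV
    rw [Filter.EventuallyEq.mlieBracket_vectorField_eq (Filter.EventuallyEq.refl _ U)
      (smulR (U := V) hW)]
    have hdf := MDifferentiableAt.mvfderiv_apply hf hV.diffFieldAt
    rw [VectorField.mlieBracket_add_right (hdf.smul_section hW.diffFieldAt)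
      (hfp.smul_section (bracket hV hW)), VectorField.mlieBracket_smul_right hdf hW.diffFieldAt,
      VectorField.mlieBracket_smul_right hfp (bracket hV hW)]
    abel
  have toMin : ∀ {U : Π x : M, TangentSpace 𝓘(ℝ, E) x}, C2FieldAt U p →
      ContMDiffAt 𝓘(ℝ, E) (𝓘(ℝ, E).prod 𝓘(ℝ, E)) (minSmoothness ℝ 2)
        (fun x ↦ (TotalSpace.mk' E x (U x) : TangentBundle 𝓘(ℝ, E) M)) p := by
    intro U hU
    exact ContMDiffAt.of_le hU minSmoothness_of_isRCLikeNormedField.le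
  have hjac := VectorField.leibniz_identity_mlieBracket_apply (I := 𝓘(ℝ, E)) (U := X) (V := Y)
    (W := f • W) (x := p) (toMin hX) (toMin hY) (toMin hfW)
  have hjac' := VectorField.leibniz_identity_mlieBracket_apply (I := 𝓘(ℝ, E)) (U := X) (V := Y)
    (W := W) (x := p) (toMin hX) (toMin hY) (toMin hW)
  rw [second hX hY, second hY hX, VectorField.mlieBracket_smul_right hfp hW.diffFieldAt, hjac']
    at hjac
  have key : (mvfderiv 𝓘(ℝ, E) f p (VectorField.mlieBracket 𝓘(ℝ, E) X Y p) -
      (mvfderiv 𝓘(ℝ, E) (fun x ↦ mvfderiv 𝓘(ℝ, E) f x (Y x)) p (X p)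
        - mvfderiv 𝓘(ℝ, E) (fun x ↦ mvfderiv 𝓘(ℝ, E) f x (X x)) p (Y p))) • W p = 0 := by
    linear_combination (norm := module) (-1 : ℝ) • hjac
  rcases smul_eq_zero.1 key with h | h
  · exact sub_eq_zero.1 h
  · exact absurd h hWp

end VectorFields

/-! ### Frames modelled on a Hermitian Lie algebra -/

section HermitianFrame

variable {E : Type*} [NormedAddCommGroup E] [NormedSpace ℝ E]
  {M : Type*} [TopologicalSpace M] [ChartedSpace E M] [IsManifold 𝓘(ℝ, E) ∞ M]
  [RiemannianBundle (fun x : M ↦ TangentSpace 𝓘(ℝ, E) x)]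
  {𝔤 : Type*} [LieRing 𝔤] [LieAlgebra ℝ 𝔤]

/-- The linear family `F` of vector fields identifies, at each point of the open set `U`, the
Hermitian Lie algebra `𝔤` with the tangent space of `M`: it takes values in `C²` fields, is onto
and isometric, and respects `J` and the brackets. On a quotient of a Lie group, `F ξ` is the local
projection of the left-invariant field `ξ`. -/
structure IsHermitianFrame (h : HermitianStructure 𝔤) (J : EndField E M) (U : Set M)
    (F : 𝔤 →ₗ[ℝ] Π x : M, TangentSpace 𝓘(ℝ, E) x) : Prop where
  isOpen : IsOpen U
  c2FieldAt : ∀ x ∈ U, ∀ ξ, C2FieldAt (F ξ) x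
  surjective : ∀ x ∈ U, ∀ v : TangentSpace 𝓘(ℝ, E) x, ∃ ξ, F ξ x = v
  inner_eq : ∀ x ∈ U, ∀ ξ η, inner ℝ (F ξ x) (F η x) = h.metric ξ η
  complex : ∀ x ∈ U, ∀ ξ, J x (F ξ x) = F (h.J ξ) x
  mlieBracket : ∀ x ∈ U, ∀ ξ η, VectorField.mlieBracket 𝓘(ℝ, E) (F ξ) (F η) x = F ⁅ξ, η⁆ x

omit [RiemannianBundle (fun x : M ↦ TangentSpace 𝓘(ℝ, E) x)] in
lemma DiffFieldAt.congr_of_eventuallyEq {X Y : Π x : M, TangentSpace 𝓘(ℝ, E) x} {p : M}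
    (hY : DiffFieldAt Y p) (hXY : ∀ᶠ x in nhds p, X x = Y x) : DiffFieldAt X p :=
  MDifferentiableAt.congr_of_eventuallyEq hY (hXY.mono fun x hx ↦ by simp [hx])

omit [RiemannianBundle (fun x : M ↦ TangentSpace 𝓘(ℝ, E) x)] in
lemma CovariantDerivative.congr_eventually
    (cov : CovariantDerivative 𝓘(ℝ, E) E (TangentSpace 𝓘(ℝ, E) : M → Type _))
    {X Y : Π x : M, TangentSpace 𝓘(ℝ, E) x} {p : M}
    (hY : DiffFieldAt Y p) (hXY : ∀ᶠ x in nhds p, X x = Y x) : cov X p = cov Y p :=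
  cov.isCovariantDerivativeOn.congr_of_eventuallyEq (hY.congr_of_eventuallyEq hXY) hY
    Filter.univ_mem hXY

namespace IsHermitianFrame

variable {h : HermitianStructure 𝔤} {J : EndField E M} {U : Set M}
  {F : 𝔤 →ₗ[ℝ] Π x : M, TangentSpace 𝓘(ℝ, E) x} {p : M}

lemma eventually_mem (hF : IsHermitianFrame h J U F) (hp : p ∈ U) : ∀ᶠ x in nhds p, x ∈ U :=
  hF.isOpen.mem_nhds hp

lemma diffFieldAt (hF : IsHermitianFrame h J U F) (hp : p ∈ U) (ξ : 𝔤) : DiffFieldAt (F ξ) p :=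
  (hF.c2FieldAt p hp ξ).diffFieldAt

lemma injective (hF : IsHermitianFrame h J U F) (hp : p ∈ U) {ξ η : 𝔤} (hξ : F ξ p = F η p) :
    ξ = η :=
  h.ext_metric fun ζ ↦ by rw [← hF.inner_eq p hp, ← hF.inner_eq p hp, hξ]

/-- Evaluation of the frame at `p`, a linear isomorphism from `𝔤` to the tangent space. -/
def evalEquiv (hF : IsHermitianFrame h J U F) (hp : p ∈ U) : 𝔤 ≃ₗ[ℝ] TangentSpace 𝓘(ℝ, E) p :=
  LinearEquiv.ofBijective (LinearMap.proj p ∘ₗ F)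
    ⟨fun _ _ hξ ↦ hF.injective hp hξ, fun v ↦ hF.surjective p hp v⟩

/-- A field is differentiable if its inner products with the frame fields are. -/
lemma diffFieldAt_of_inner [FiniteDimensional ℝ 𝔤] (hF : IsHermitianFrame h J U F) (hp : p ∈ U)
    {W : Π x : M, TangentSpace 𝓘(ℝ, E) x}
    (hW : ∀ ξ, MDifferentiableAt 𝓘(ℝ, E) 𝓘(ℝ, ℝ) (fun x ↦ inner ℝ (W x) (F ξ x)) p) :
    DiffFieldAt W p := by
  obtain ⟨n, e, -, he⟩ := h.exists_orthonormal
  have hsum : DiffFieldAt (fun x ↦ ∑ i, (inner ℝ (W x) (F (e i) x) : ℝ) • F (e i) x) p :=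
    MDifferentiableAt.sum_section fun i _ ↦ (hW (e i)).smul_section (hF.diffFieldAt hp (e i))
  refine hsum.congr_of_eventuallyEq ?_
  filter_upwards [hF.eventually_mem hp] with x hx
  obtain ⟨ξ, hξ⟩ := hF.surjective x hx (W x)
  simp only [← hξ, hF.inner_eq x hx]
  conv_lhs => rw [he ξ]
  simp

variable [FiniteDimensional ℝ E]
  {cov : CovariantDerivative 𝓘(ℝ, E) E (TangentSpace 𝓘(ℝ, E) : M → Type _)}

/-- At a point, the Chern connection of `M` is given on the frame fields by a Chern connection of
the Lie algebra. -/
lemma exists_isChern_at (hF : IsHermitianFrame h J U F) (hcov : IsChernConnection J cov)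
    (hp : p ∈ U) :
    ∃ D, h.IsChern D ∧ ∀ ξ η, cov (F η) p (F ξ p) = F (D ξ η) p := by
  let D : 𝔤 →ₗ[ℝ] 𝔤 →ₗ[ℝ] 𝔤 := LinearMap.mk₂ ℝ
    (fun ξ η ↦ (hF.evalEquiv hp).symm (cov (F η) p (F ξ p)))
    (fun ξ ξ' η ↦ by simp) (fun t ξ η ↦ by simp)
    (fun ξ η η' ↦ by
      rw [map_add, cov.isCovariantDerivativeOn.add (hF.diffFieldAt hp η) (hF.diffFieldAt hp η')]
      simp)
    (fun t ξ η ↦ by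
      rw [map_smul, cov.isCovariantDerivativeOn.smul_const t (hF.diffFieldAt hp η)]
      simp)
  have hD : ∀ ξ η, cov (F η) p (F ξ p) = F (D ξ η) p := fun ξ η ↦
    ((hF.evalEquiv hp).apply_symm_apply (cov (F η) p (F ξ p))).symm
  have hcomplete : CompleteSpace E := FiniteDimensional.complete ℝ E
  have htor : ∀ ξ η, cov.torsion p (F ξ p) (F η p) = F (D ξ η - D η ξ - ⁅ξ, η⁆) p := by
    intro ξ η
    rw [cov.torsion_apply (hF.diffFieldAt hp ξ) (hF.diffFieldAt hp η), hD, hD,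
      hF.mlieBracket p hp]
    simp
  refine ⟨D, ⟨fun ξ η ζ ↦ ?_, fun ξ η ↦ ?_, fun ξ η ↦ ?_⟩, hD⟩
  · have h1 := hcov.metric p (F η) (F ζ) (F ξ p) (hF.diffFieldAt hp η) (hF.diffFieldAt hp ζ)
    rw [hD, hD, hF.inner_eq p hp, hF.inner_eq p hp] at h1
    rw [← h1]
    have h2 : (fun x ↦ (inner ℝ (F η x) (F ζ x) : ℝ)) =ᶠ[nhds p] fun _ ↦ h.metric η ζ := by
      filter_upwards [hF.eventually_mem hp] with x hx
      exact hF.inner_eq x hx η ζ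
    rw [mvfderiv, h2.mfderiv_eq, mfderiv_const]
    exact map_zero (NormedSpace.fromTangentSpace (𝕜 := ℝ) (h.metric η ζ))
  · apply hF.injective hp
    have h1 := hcov.complex p (F η) (F ξ p) (hF.diffFieldAt hp η)
    have h2 : ∀ᶠ x in nhds p, applyField J (F η) x = F (h.J η) x := by
      filter_upwards [hF.eventually_mem hp] with x hx
      exact hF.complex x hx η
    rw [cov.congr_eventually (hF.diffFieldAt hp _) h2, hD, hD, hF.complex p hp] at h1
    exact h1
  · apply hF.injective hp
    have h1 := hcov.torsion p (F ξ p) (F η p)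
    rw [hF.complex p hp, hF.complex p hp] at h1
    rw [← htor, map_neg, Pi.neg_apply, ← htor]
    exact h1

/-- On all of `U`, the Chern connection of `M` is given on the frame fields by one and the same
Chern connection of the Lie algebra, by uniqueness of the latter. -/
lemma exists_isChern (hF : IsHermitianFrame h J U F) (hcov : IsChernConnection J cov)
    (hp : p ∈ U) :
    ∃ D, h.IsChern D ∧ ∀ x ∈ U, ∀ ξ η, cov (F η) x (F ξ x) = F (D ξ η) x := by
  obtain ⟨D, hD, -⟩ := hF.exists_isChern_at hcov hp
  refine ⟨D, hD, fun x hx ↦ ?_⟩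
  obtain ⟨D', hD', h'⟩ := hF.exists_isChern_at hcov hx
  rwa [hD'.unique hD] at h'

omit [FiniteDimensional ℝ E] in
lemma connectionCurvature_eq (hF : IsHermitianFrame h J U F) {D : 𝔤 →ₗ[ℝ] 𝔤 →ₗ[ℝ] 𝔤}
    (hD : ∀ x ∈ U, ∀ ξ η, cov (F η) x (F ξ x) = F (D ξ η) x) (hp : p ∈ U) (ξ η ζ : 𝔤) :
    connectionCurvature cov (F ξ) (F η) (F ζ) p = F (algCurvature D ξ η ζ) p := by
  have h1 : ∀ ξ η, ∀ᶠ x in nhds p, cov (F η) x (F ξ x) = F (D ξ η) x := fun ξ η ↦ by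
    filter_upwards [hF.eventually_mem hp] with x hx
    exact hD x hx ξ η
  rw [connectionCurvature, cov.congr_eventually (hF.diffFieldAt hp _) (h1 η ζ),
    cov.congr_eventually (hF.diffFieldAt hp _) (h1 ξ ζ), hD p hp, hD p hp, hF.mlieBracket p hp,
    hD p hp]
  simp [algCurvature]

omit [FiniteDimensional ℝ E] in
lemma hasConstantHolSec (hF : IsHermitianFrame h J U F) {D : 𝔤 →ₗ[ℝ] 𝔤 →ₗ[ℝ] 𝔤}
    (hD : ∀ x ∈ U, ∀ ξ η, cov (F η) x (F ξ x) = F (D ξ η) x) (hp : p ∈ U) {c : ℝ}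
    (hc : HasConstantHolSecCurvature J cov c) : h.HasConstantHolSec D c := by
  intro ξ
  have h1 := hc p (F ξ) (hF.c2FieldAt p hp ξ)
  have h2 : ∀ᶠ x in nhds p, applyField J (F ξ) x = F (h.J ξ) x := by
    filter_upwards [hF.eventually_mem hp] with x hx
    exact hF.complex x hx ξ
  -- `J (F ξ)` is a frame field only on `U`; all terms depend only on germs at `p`
  have h3 : connectionCurvature cov (F ξ) (applyField J (F ξ)) (applyField J (F ξ)) p
      = connectionCurvature cov (F ξ) (F (h.J ξ)) (F (h.J ξ)) p := by
    have h4 : ∀ ζ, ∀ᶠ x in nhds p, cov (applyField J (F ξ)) x (F ζ x) = F (D ζ (h.J ξ)) x := by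
      intro ζ
      filter_upwards [h2.eventually_nhds, hF.eventually_mem hp] with x hx hxU
      rw [cov.congr_eventually (hF.diffFieldAt hxU _) hx, hD x hxU]
    have h5 : ∀ᶠ x in nhds p, cov (applyField J (F ξ)) x (applyField J (F ξ) x)
        = F (D (h.J ξ) (h.J ξ)) x := by
      filter_upwards [h2, h4 (h.J ξ)] with x hx hx'
      rw [hx, hx']
    have h6 : ∀ ζ, ∀ᶠ x in nhds p, cov (F (h.J ξ)) x (F ζ x) = F (D ζ (h.J ξ)) x := by
      intro ζ
      filter_upwards [hF.eventually_mem hp] with x hx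
      rw [hD x hx]
    have hdiff := hF.diffFieldAt hp
    rw [connectionCurvature, connectionCurvature, cov.congr_eventually (hdiff _) h5,
      cov.congr_eventually (hdiff _) (h4 ξ), cov.congr_eventually (hdiff _) (h6 (h.J ξ)),
      cov.congr_eventually (hdiff _) (h6 ξ), cov.congr_eventually (hdiff _) h2, h2.self_of_nhds,
      Filter.EventuallyEq.mlieBracket_vectorField_eq (Filter.EventuallyEq.refl _ (F ξ)) h2]
  rw [h3, hF.connectionCurvature_eq hD hp, hF.inner_eq p hp, hF.inner_eq p hp] at h1
  exact h1

variable [FiniteDimensional ℝ 𝔤]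
  [IsContMDiffRiemannianBundle 𝓘(ℝ, E) ∞ E (fun x : M ↦ TangentSpace 𝓘(ℝ, E) x)]

omit [FiniteDimensional ℝ E] in
lemma diffFieldAt_cov (hF : IsHermitianFrame h J U F) {D : 𝔤 →ₗ[ℝ] 𝔤 →ₗ[ℝ] 𝔤}
    (hD : ∀ x ∈ U, ∀ ξ η, cov (F η) x (F ξ x) = F (D ξ η) x) (hp : p ∈ U) (ζ : 𝔤)
    {Y : Π x : M, TangentSpace 𝓘(ℝ, E) x} (hY : DiffFieldAt Y p) :
    DiffFieldAt (fun x ↦ cov (F ζ) x (Y x)) p := by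
  obtain ⟨n, e, -, he⟩ := h.exists_orthonormal
  have hc : ∀ i, MDifferentiableAt 𝓘(ℝ, E) 𝓘(ℝ, ℝ) (fun x ↦ inner ℝ (Y x) (F (e i) x)) p :=
    fun i ↦ MDifferentiableAt.inner_bundle hY (hF.diffFieldAt hp (e i))
  have hsum : DiffFieldAt
      (fun x ↦ ∑ i, (inner ℝ (Y x) (F (e i) x) : ℝ) • F (D (e i) ζ) x) p :=
    MDifferentiableAt.sum_section fun i _ ↦ (hc i).smul_section (hF.diffFieldAt hp _)
  refine hsum.congr_of_eventuallyEq ?_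
  filter_upwards [hF.eventually_mem hp] with x hx
  obtain ⟨ξ, hξ⟩ := hF.surjective x hx (Y x)
  simp only [← hξ, hF.inner_eq x hx, hD x hx]
  conv_lhs => rw [he ξ]
  simp

/-- The curvature `R(X, Y) F ζ` is tensorial in `X` and `Y`, so it vanishes for all differentiable
fields `X`, `Y` if it vanishes for frame fields. -/
lemma connectionCurvature_frame_eq_zero (hF : IsHermitianFrame h J U F)
    {D : 𝔤 →ₗ[ℝ] 𝔤 →ₗ[ℝ] 𝔤}
    (hD : ∀ x ∈ U, ∀ ξ η, cov (F η) x (F ξ x) = F (D ξ η) x) (hp : p ∈ U)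
    (hflat : ∀ ξ η ζ, algCurvature D ξ η ζ = 0) (ζ : 𝔤)
    {X Y : Π x : M, TangentSpace 𝓘(ℝ, E) x} (hX : DiffFieldAt X p) (hY : DiffFieldAt Y p) :
    connectionCurvature cov X Y (F ζ) p = 0 := by
  have hcomplete : CompleteSpace E := FiniteDimensional.complete ℝ E
  have hd := fun {Y} ↦ hF.diffFieldAt_cov (Y := Y) hD hp ζ
  have t : ∀ X : Π x : M, TangentSpace 𝓘(ℝ, E) x,
      TensorialAt 𝓘(ℝ, E) E (fun Y ↦ connectionCurvature cov X Y (F ζ) p) p := by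
    intro X
    constructor
    · intro f σ hf hσ
      have h1 : (fun x ↦ cov (F ζ) x ((f • σ) x)) = f • fun x ↦ cov (F ζ) x (σ x) := by
        ext x; simp
      rw [connectionCurvature, connectionCurvature, h1,
        cov.isCovariantDerivativeOn.leibniz (hd hσ) hf, VectorField.mlieBracket_smul_right hf hσ]
      simp
      module
    · intro σ σ' hσ hσ'
      have h1 : (fun x ↦ cov (F ζ) x ((σ + σ') x))
          = (fun x ↦ cov (F ζ) x (σ x)) + fun x ↦ cov (F ζ) x (σ' x) := by
        ext x; simp
      rw [connectionCurvature, connectionCurvature, connectionCurvature, h1,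
        cov.isCovariantDerivativeOn.add (hd hσ) (hd hσ'),
        VectorField.mlieBracket_add_right hσ hσ']
      simp
      abel
  have hswap : ∀ X Y : Π x : M, TangentSpace 𝓘(ℝ, E) x,
      connectionCurvature cov X Y (F ζ) p = -connectionCurvature cov Y X (F ζ) p := by
    intro X Y
    rw [connectionCurvature, connectionCurvature, VectorField.mlieBracket_swap_apply]
    simp
    abel
  obtain ⟨ξ, hξ⟩ := hF.surjective p hp (X p)
  obtain ⟨η, hη⟩ := hF.surjective p hp (Y p)
  have e1 := (t X).pointwise hY (hF.diffFieldAt hp η) hη.symm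
  have e2 := (t (F η)).pointwise hX (hF.diffFieldAt hp ξ) hξ.symm
  rw [e1, hswap, e2, hF.connectionCurvature_eq hD hp, hflat]
  simp

/-- The curvature vanishes on all `C²` fields if the curvature of the Lie algebra does. By metric
compatibility and the formula for `[X, Y] f`, one has `⟨R(X, Y)Z, F ζ⟩ = -⟨Z, R(X, Y) F ζ⟩`. -/
theorem connectionCurvature_eq_zero (hF : IsHermitianFrame h J U F)
    {D : 𝔤 →ₗ[ℝ] 𝔤 →ₗ[ℝ] 𝔤} (hcov : IsChernConnection J cov)
    (hD : ∀ x ∈ U, ∀ ξ η, cov (F η) x (F ξ x) = F (D ξ η) x) (hp : p ∈ U)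
    (hflat : ∀ ξ η ζ, algCurvature D ξ η ζ = 0)
    {X Y Z : Π x : M, TangentSpace 𝓘(ℝ, E) x} (hX : C2FieldAt X p) (hY : C2FieldAt Y p)
    (hZ : C2FieldAt Z p) : connectionCurvature cov X Y Z p = 0 := by
  have : IsContMDiffRiemannianBundle 𝓘(ℝ, E) 2 E (fun x : M ↦ TangentSpace 𝓘(ℝ, E) x) :=
    inferInstance
  have hf : ∀ ζ, ContMDiffAt 𝓘(ℝ, E) 𝓘(ℝ, ℝ) 2 (fun x ↦ (inner ℝ (Z x) (F ζ x) : ℝ)) p :=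
    fun ζ ↦ ContMDiffAt.inner_bundle hZ (hF.c2FieldAt p hp ζ)
  -- metric compatibility near `p`
  have hmet : ∀ (ζ : 𝔤) (V : Π x : M, TangentSpace 𝓘(ℝ, E) x), ∀ᶠ x in nhds p,
      inner ℝ (cov Z x (V x)) (F ζ x) =
        mvfderiv 𝓘(ℝ, E) (fun x ↦ (inner ℝ (Z x) (F ζ x) : ℝ)) x (V x)
          - inner ℝ (Z x) (cov (F ζ) x (V x)) := by
    intro ζ V
    filter_upwards [hZ.eventually, hF.eventually_mem hp] with x hx hxU
    rw [hcov.metric x Z (F ζ) (V x) hx.diffFieldAt (hF.diffFieldAt hxU ζ)]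
    ring
  have hdF := fun ζ {V} ↦ hF.diffFieldAt_cov (Y := V) hD hp ζ
  have hdf : ∀ (ζ : 𝔤) {V : Π x : M, TangentSpace 𝓘(ℝ, E) x}, DiffFieldAt V p →
      MDifferentiableAt 𝓘(ℝ, E) 𝓘(ℝ, ℝ)
        (fun x ↦ mvfderiv 𝓘(ℝ, E) (fun x ↦ (inner ℝ (Z x) (F ζ x) : ℝ)) x (V x)) p :=
    fun ζ _ hV ↦ MDifferentiableAt.mvfderiv_apply (hf ζ) hV
  have hdi : ∀ (ζ : 𝔤) {V : Π x : M, TangentSpace 𝓘(ℝ, E) x}, DiffFieldAt V p →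
      MDifferentiableAt 𝓘(ℝ, E) 𝓘(ℝ, ℝ)
        (fun x ↦ (inner ℝ (Z x) (cov (F ζ) x (V x)) : ℝ)) p :=
    fun ζ _ hV ↦ MDifferentiableAt.inner_bundle hZ.diffFieldAt (hdF ζ hV)
  -- without this, the junk value of `cov` at a nondifferentiable field would intervene
  have hdZ : ∀ {V : Π x : M, TangentSpace 𝓘(ℝ, E) x}, DiffFieldAt V p →
      DiffFieldAt (fun x ↦ cov Z x (V x)) p := by
    intro V hV
    refine hF.diffFieldAt_of_inner hp fun ζ ↦ ?_
    exact ((hdf ζ hV).sub (hdi ζ hV)).congr_of_eventuallyEq (hmet ζ V)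
  -- the second covariant derivative, tested against a frame field
  have second : ∀ (ζ : 𝔤) {V : Π x : M, TangentSpace 𝓘(ℝ, E) x} (w : TangentSpace 𝓘(ℝ, E) p),
      DiffFieldAt V p → (inner ℝ (cov (fun x ↦ cov Z x (V x)) p w) (F ζ p) : ℝ) =
        mvfderiv 𝓘(ℝ, E)
            (fun x ↦ mvfderiv 𝓘(ℝ, E) (fun x ↦ (inner ℝ (Z x) (F ζ x) : ℝ)) x (V x)) p w
          - inner ℝ (cov Z p w) (cov (F ζ) p (V p))
          - inner ℝ (Z p) (cov (fun x ↦ cov (F ζ) x (V x)) p w)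
          - inner ℝ (cov Z p (V p)) (cov (F ζ) p w) := by
    intro ζ V w hV
    have m1 := hcov.metric p _ (F ζ) w (hdZ hV) (hF.diffFieldAt hp ζ)
    have m2 := hcov.metric p Z _ w hZ.diffFieldAt (hdF ζ hV)
    have m3 : mvfderiv 𝓘(ℝ, E) (fun x ↦ (inner ℝ (cov Z x (V x)) (F ζ x) : ℝ)) p =
        mvfderiv 𝓘(ℝ, E)
            (fun x ↦ mvfderiv 𝓘(ℝ, E) (fun x ↦ (inner ℝ (Z x) (F ζ x) : ℝ)) x (V x)) p
          - mvfderiv 𝓘(ℝ, E) (fun x ↦ (inner ℝ (Z x) (cov (F ζ) x (V x)) : ℝ)) p := by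
      rw [← mvfderiv_fun_sub (hdf ζ hV) (hdi ζ hV)]
      have e := hmet ζ V
      rw [mvfderiv, mvfderiv, Filter.EventuallyEq.mfderiv_eq e, e.self_of_nhds]
    rw [m3, sub_apply, m2] at m1
    linarith
  obtain ⟨κ, hκ⟩ := hF.surjective p hp (connectionCurvature cov X Y Z p)
  suffices hz : ∀ ζ, (inner ℝ (connectionCurvature cov X Y Z p) (F ζ p) : ℝ) = 0 by
    have h0 := hz κ
    rw [← hκ, hF.inner_eq p hp, h.metric_self_eq_zero] at h0
    rw [← hκ, h0]
    simp
  intro ζ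
  have h0 := hF.connectionCurvature_frame_eq_zero hD hp hflat ζ hX.diffFieldAt
    hY.diffFieldAt
  have h1 : (inner ℝ (Z p) (connectionCurvature cov X Y (F ζ) p) : ℝ) = 0 := by
    rw [h0, inner_zero_right]
  have h2 := hcov.metric p Z (F ζ) (VectorField.mlieBracket 𝓘(ℝ, E) X Y p) hZ.diffFieldAt
    (hF.diffFieldAt hp ζ)
  rw [mvfderiv_mlieBracket (hf ζ) hX hY] at h2
  have s1 := second ζ (X p) hY.diffFieldAt
  have s2 := second ζ (Y p) hX.diffFieldAt
  simp only [connectionCurvature, inner_sub_left, inner_sub_right] at h1 ⊢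
  linarith

end IsHermitianFrame
end HermitianFrame

/-! ### The frame of left-invariant fields on a quotient of a Lie group -/

section QuotientFrame

variable {E : Type*} [NormedAddCommGroup E] [NormedSpace ℝ E]
  {G : Type*} [TopologicalSpace G] [ChartedSpace E G]
  {M : Type*} [TopologicalSpace M] [ChartedSpace E M]
  {q : G → M} {a : G} {x : M}

/-- The lift of `J` corresponds to `J` under the differential of the local diffeomorphism `q`. -/
lemma mfderiv_liftEnd (hq : IsLocalDiffeomorph 𝓘(ℝ, E) 𝓘(ℝ, E) ∞ q) (J : EndField E M)
    (b : G) (v : TangentSpace 𝓘(ℝ, E) b) :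
    mfderiv 𝓘(ℝ, E) 𝓘(ℝ, E) q b (liftEnd q J b v)
      = J (q b) (mfderiv 𝓘(ℝ, E) 𝓘(ℝ, E) q b v) := by
  have h := hq.mfderivToContinuousLinearEquiv_coe (by simp) b
  rw [liftEnd, ← h]
  simp

/-- On its whole domain, a local inverse of `q` has an invertible differential, whose inverse is
the differential of `q`. -/
lemma localInverse_inverse_mfderiv (hq : IsLocalDiffeomorph 𝓘(ℝ, E) 𝓘(ℝ, E) ∞ q)
    (hx : x ∈ (hq a).localInverse.source) :
    (mfderiv 𝓘(ℝ, E) 𝓘(ℝ, E) (hq a).localInverse x).IsInvertible ∧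
    ((mfderiv 𝓘(ℝ, E) 𝓘(ℝ, E) (hq a).localInverse x).inverse : E →L[ℝ] E)
      = mfderiv 𝓘(ℝ, E) 𝓘(ℝ, E) q ((hq a).localInverse x) := by
  have hs := (hq a).localInverse.mdifferentiableAt (by simp) hx
  have hd := hq.mdifferentiable (by simp) ((hq a).localInverse x)
  have hqs := (hq a).localInverse_right_inv hx
  have e1 : mfderiv 𝓘(ℝ, E) 𝓘(ℝ, E) (q ∘ (hq a).localInverse) x = ContinuousLinearMap.id ℝ E := by
    rw [((hq a).localInverse_eqOn_right.eventuallyEq_of_mem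
      ((hq a).localInverse_open_source.mem_nhds hx)).mfderiv_eq]
    exact mfderiv_id
  have e2 : mfderiv 𝓘(ℝ, E) 𝓘(ℝ, E) ((hq a).localInverse ∘ q) ((hq a).localInverse x)
      = ContinuousLinearMap.id ℝ E := by
    rw [((hq a).localInverse_eqOn_left.eventuallyEq_of_mem
      ((hq a).localInverse.open_target.mem_nhds ((hq a).localInverse.map_source hx))).mfderiv_eq]
    exact mfderiv_id
  rw [mfderiv_comp _ hd hs] at e1
  rw [mfderiv_comp _ (by rw [hqs]; exact hs) hd, hqs] at e2
  have h := ContinuousLinearMap.inverse_eq e2 e1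
  refine ⟨⟨ContinuousLinearEquiv.equivOfInverse _ _ (fun v ↦ congrArg (· v) e1)
    (fun v ↦ congrArg (· v) e2), rfl⟩, h⟩

variable [Group G]

/-- The left-invariant vector fields of `G`, pulled back to `M` along a local section `s` of the
quotient map. It is meaningful only where the differential of `s` is invertible. -/
def sectionFrame (s : M → G) :
    GroupLieAlgebra 𝓘(ℝ, E) G →ₗ[ℝ] Π x : M, TangentSpace 𝓘(ℝ, E) x where
  toFun ξ := VectorField.mpullback 𝓘(ℝ, E) 𝓘(ℝ, E) s (mulInvariantVectorField ξ)
  map_add' ξ η := by rw [mulInvariantVectorField_add, VectorField.mpullback_add]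
  map_smul' t ξ := by
    rw [mulInvariantVectorField_smul, VectorField.mpullback_const_smul, RingHom.id_apply]

/-- A left-invariant field of endomorphisms maps left-invariant fields to left-invariant fields.
-/
lemma IsLeftInvariantEnd.apply_mulInvariantVectorField {A : EndField E G}
    (hA : IsLeftInvariantEnd A) (b : G) (ξ : GroupLieAlgebra 𝓘(ℝ, E) G) :
    A b (mulInvariantVectorField ξ b)
      = mulInvariantVectorField (A 1 ξ : GroupLieAlgebra 𝓘(ℝ, E) G) b := by
  have h : ∀ c : G, c = b → A c (mfderiv 𝓘(ℝ, E) 𝓘(ℝ, E) (b * ·) 1 ξ : E) =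
      (mfderiv 𝓘(ℝ, E) 𝓘(ℝ, E) (b * ·) 1 (A 1 ξ) : E) → A b (mulInvariantVectorField ξ b)
        = mulInvariantVectorField (A 1 ξ : GroupLieAlgebra 𝓘(ℝ, E) G) b := by
    rintro c rfl h
    exact h
  exact h (b * 1) (mul_one b) (hA b 1 ξ)

/-- A left-invariant form is constant on left-invariant fields. -/
lemma IsLeftInvariantForm.apply_mulInvariantVectorField
    {B : Π a : G, TangentSpace 𝓘(ℝ, E) a → TangentSpace 𝓘(ℝ, E) a → ℝ}
    (hB : IsLeftInvariantForm B) (b : G) (ξ η : GroupLieAlgebra 𝓘(ℝ, E) G) :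
    B b (mulInvariantVectorField ξ b) (mulInvariantVectorField η b) = B 1 ξ η := by
  have h : ∀ c : G, c = b → B c (mfderiv 𝓘(ℝ, E) 𝓘(ℝ, E) (b * ·) 1 ξ : E)
      (mfderiv 𝓘(ℝ, E) 𝓘(ℝ, E) (b * ·) 1 η : E) = B 1 ξ η →
      B b (mulInvariantVectorField ξ b) (mulInvariantVectorField η b) = B 1 ξ η := by
    rintro c rfl h
    exact h
  exact h (b * 1) (mul_one b) (hB b 1 ξ η)

section Frame

variable (hq : IsLocalDiffeomorph 𝓘(ℝ, E) 𝓘(ℝ, E) ∞ q)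

include hq

/-- The pullback of a left-invariant field along a local inverse of `q` is its image under the
differential of `q`. -/
lemma sectionFrame_apply (hx : x ∈ (hq a).localInverse.source) (ξ : GroupLieAlgebra 𝓘(ℝ, E) G) :
    sectionFrame (hq a).localInverse ξ x
      = (mfderiv 𝓘(ℝ, E) 𝓘(ℝ, E) q ((hq a).localInverse x)
          (mulInvariantVectorField ξ ((hq a).localInverse x)) : E) := by
  rw [← (localInverse_inverse_mfderiv hq hx).2]
  rfl

lemma sectionFrame_complex {J : EndField E M} (hJ : IsLeftInvariantEnd (liftEnd q J))
    (hx : x ∈ (hq a).localInverse.source) (ξ : GroupLieAlgebra 𝓘(ℝ, E) G) :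
    J x (sectionFrame (hq a).localInverse ξ x)
      = sectionFrame (hq a).localInverse (liftEnd q J 1 ξ : GroupLieAlgebra 𝓘(ℝ, E) G) x := by
  rw [sectionFrame_apply hq hx, sectionFrame_apply hq hx]
  rw [← hJ.apply_mulInvariantVectorField, mfderiv_liftEnd hq]
  have h : ∀ (y : M) (v : E), y = x → (J x v : E) = J y v := by
    rintro y v rfl
    rfl
  exact h _ _ ((hq a).localInverse_right_inv hx)

lemma sectionFrame_inner [RiemannianBundle (fun x : M ↦ TangentSpace 𝓘(ℝ, E) x)]
    (hg : IsLeftInvariantForm (liftMetric (E := E) q))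
    (hx : x ∈ (hq a).localInverse.source) (ξ η : GroupLieAlgebra 𝓘(ℝ, E) G) :
    (inner ℝ (sectionFrame (hq a).localInverse ξ x) (sectionFrame (hq a).localInverse η x) : ℝ)
      = liftMetric q 1 ξ η := by
  rw [sectionFrame_apply hq hx, sectionFrame_apply hq hx, ← hg.apply_mulInvariantVectorField
    ((hq a).localInverse x)]
  have h : ∀ (y : M) (v w : TangentSpace 𝓘(ℝ, E) y), y = x →
      inner ℝ (show TangentSpace 𝓘(ℝ, E) x from v) (show TangentSpace 𝓘(ℝ, E) x from w)
        = inner ℝ v w := by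
    rintro y v w rfl
    rfl
  exact h _ _ _ ((hq a).localInverse_right_inv hx)

variable [LieGroup 𝓘(ℝ, E) ∞ G]

omit hq in
lemma mulInvariantVectorField_bijective (b : G) : Function.Bijective
    (fun ξ : GroupLieAlgebra 𝓘(ℝ, E) G ↦ mulInvariantVectorField ξ b) :=
  ((⟨Equiv.mulLeft b, contMDiff_mul_left, contMDiff_mul_left⟩ :
    G ≃ₘ^∞⟮𝓘(ℝ, E), 𝓘(ℝ, E)⟯ G).mfderivToContinuousLinearEquiv (by simp) 1).bijective

lemma sectionFrame_bijective (hx : x ∈ (hq a).localInverse.source) :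
    Function.Bijective (fun ξ : GroupLieAlgebra 𝓘(ℝ, E) G ↦
      sectionFrame (hq a).localInverse ξ x) := by
  have h := (hq.mfderivToContinuousLinearEquiv (n := ∞) (by simp)
    ((hq a).localInverse x)).bijective.comp
      (mulInvariantVectorField_bijective (E := E) ((hq a).localInverse x))
  have he : (fun ξ : GroupLieAlgebra 𝓘(ℝ, E) G ↦ sectionFrame (hq a).localInverse ξ x) = _ :=
    funext fun ξ ↦ sectionFrame_apply hq hx ξ
  rw [he]
  exact h

variable [IsManifold 𝓘(ℝ, E) ∞ M] [FiniteDimensional ℝ E]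

lemma c2FieldAt_sectionFrame (hx : x ∈ (hq a).localInverse.source)
    (ξ : GroupLieAlgebra 𝓘(ℝ, E) G) : C2FieldAt (sectionFrame (hq a).localInverse ξ) x := by
  have hcomplete : CompleteSpace E := FiniteDimensional.complete ℝ E
  have h1 := (contMDiffAt_mulInvariantVectorField ξ (g := (hq a).localInverse x)).of_le
    (minSmoothness_of_isRCLikeNormedField (𝕜 := ℝ) (n := 2)).ge
  exact ContMDiffAt.mpullback_vectorField_preimage (n := ∞) h1
    ((hq a).localInverse_contMDiffOn.contMDiffAt ((hq a).localInverse_open_source.mem_nhds hx))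
    (localInverse_inverse_mfderiv hq hx).1 (WithTop.coe_le_coe.2 (le_top : (3 : ℕ∞) ≤ ⊤))

lemma mlieBracket_sectionFrame (hx : x ∈ (hq a).localInverse.source)
    (ξ η : GroupLieAlgebra 𝓘(ℝ, E) G) :
    VectorField.mlieBracket 𝓘(ℝ, E) (sectionFrame (hq a).localInverse ξ)
      (sectionFrame (hq a).localInverse η) x = sectionFrame (hq a).localInverse ⁅ξ, η⁆ x := by
  have hcomplete : CompleteSpace E := FiniteDimensional.complete ℝ E
  have h := VectorField.mpullback_mlieBracket (n := ∞) (f := (hq a).localInverse) (x₀ := x)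
    (mdifferentiableAt_mulInvariantVectorField ξ) (mdifferentiableAt_mulInvariantVectorField η)
    ((hq a).localInverse_contMDiffOn.contMDiffAt ((hq a).localInverse_open_source.mem_nhds hx))
    (by
      rw [minSmoothness_of_isRCLikeNormedField]
      exact WithTop.coe_le_coe.2 (le_top : (2 : ℕ∞) ≤ ⊤))
  rw [← mulInvariantVector_mlieBracket] at h
  exact h.symm

end Frame

section Hermitian

variable [LieGroup 𝓘(ℝ, E) ∞ G] [IsManifold 𝓘(ℝ, E) ∞ M] [FiniteDimensional ℝ E]
  [RiemannianBundle (fun x : M ↦ TangentSpace 𝓘(ℝ, E) x)]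

omit [RiemannianBundle (fun x : M ↦ TangentSpace 𝓘(ℝ, E) x)] in
/-- The complex structure induced on the Lie algebra of `G` is integrable: the integrability
condition on `M` is evaluated on frame fields at the image of `1`. -/
lemma liftEnd_one_integrable (hq : IsLocalDiffeomorph 𝓘(ℝ, E) 𝓘(ℝ, E) ∞ q) {J : EndField E M}
    (hJ : IsComplexStructure J) (hinv : IsLeftInvariantEnd (liftEnd q J))
    (ξ η : GroupLieAlgebra 𝓘(ℝ, E) G) :
    letI j : GroupLieAlgebra 𝓘(ℝ, E) G →L[ℝ] GroupLieAlgebra 𝓘(ℝ, E) G := liftEnd q J 1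
    ⁅ξ, η⁆ - ⁅j ξ, j η⁆ + j ⁅j ξ, η⁆ + j ⁅ξ, j η⁆ = 0 := by
  have hx := (hq 1).localInverse_mem_source
  have hcong : ∀ ζ : GroupLieAlgebra 𝓘(ℝ, E) G,
      applyField J (sectionFrame (hq 1).localInverse ζ) =ᶠ[nhds (q 1)]
        sectionFrame (hq 1).localInverse (liftEnd q J 1 ζ : GroupLieAlgebra 𝓘(ℝ, E) G) := by
    intro ζ
    filter_upwards [(hq 1).localInverse_open_source.mem_nhds hx] with x hx
    exact sectionFrame_complex hq hinv hx ζ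
  have h := hJ.integrable (q 1) _ _ (c2FieldAt_sectionFrame hq hx ξ).diffFieldAt
    (c2FieldAt_sectionFrame hq hx η).diffFieldAt
  have hrefl := fun ζ : GroupLieAlgebra 𝓘(ℝ, E) G ↦
    Filter.EventuallyEq.refl (nhds (q 1)) (sectionFrame (hq 1).localInverse ζ)
  rw [Filter.EventuallyEq.mlieBracket_vectorField_eq (hcong ξ) (hcong η),
    Filter.EventuallyEq.mlieBracket_vectorField_eq (hcong ξ) (hrefl η),
    Filter.EventuallyEq.mlieBracket_vectorField_eq (hrefl ξ) (hcong η)] at h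
  simp only [mlieBracket_sectionFrame hq hx, sectionFrame_complex hq hinv hx] at h
  apply (sectionFrame_bijective hq hx).injective
  simpa using h

/-- The Hermitian structure on the Lie algebra of `G`, obtained by lifting that of `M` along `q`
to the tangent space at `1`. -/
def quotientHermitianStructure (hq : IsLocalDiffeomorph 𝓘(ℝ, E) 𝓘(ℝ, E) ∞ q)
    {J : EndField E M} (hJ : IsComplexStructure J) (hg : IsHermitianMetric J)
    (hinv : IsLeftInvariantEnd (liftEnd q J)) :
    HermitianStructure (GroupLieAlgebra 𝓘(ℝ, E) G) where
  J := (liftEnd q J 1 : GroupLieAlgebra 𝓘(ℝ, E) G →L[ℝ] GroupLieAlgebra 𝓘(ℝ, E) G)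
  metric := LinearMap.mk₂ ℝ (liftMetric q 1)
    (fun ξ η ζ ↦ by simp only [liftMetric, map_add, inner_add_left])
    (fun t ξ η ↦ by simp only [liftMetric, map_smul, real_inner_smul_left, smul_eq_mul])
    (fun ξ η ζ ↦ by simp only [liftMetric, map_add, inner_add_right])
    (fun t ξ η ↦ by simp only [liftMetric, map_smul, real_inner_smul_right, smul_eq_mul])
  J_sq ξ := by
    have h := mfderiv_liftEnd hq J 1 (liftEnd q J 1 ξ)
    rw [mfderiv_liftEnd hq J 1 ξ, hJ.sq] at h
    exact (hq.mfderivToContinuousLinearEquiv (by simp) 1).injective (h.trans (map_neg _ _).symm)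
  integrable := liftEnd_one_integrable hq hJ hinv
  symm ξ η := by
    change liftMetric q 1 ξ η = liftMetric q 1 η ξ
    exact real_inner_comm _ _
  pos ξ hξ := by
    change 0 < liftMetric q 1 ξ ξ
    exact real_inner_self_pos.2 fun h ↦ hξ <|
      (hq.mfderivToContinuousLinearEquiv (by simp) 1).injective (h.trans (map_zero _).symm)
  compatible ξ η := by
    change liftMetric q 1 (liftEnd q J 1 ξ) (liftEnd q J 1 η) = liftMetric q 1 ξ η
    rw [liftMetric, mfderiv_liftEnd hq, mfderiv_liftEnd hq, hg, liftMetric]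

/-- The projections of the left-invariant fields form a Hermitian frame near each point of the
quotient. -/
lemma isHermitianFrame_sectionFrame (hq : IsLocalDiffeomorph 𝓘(ℝ, E) 𝓘(ℝ, E) ∞ q)
    {J : EndField E M} (hJ : IsComplexStructure J) (hg : IsHermitianMetric J)
    (hinv : IsLeftInvariantEnd (liftEnd q J))
    (hginv : IsLeftInvariantForm (liftMetric (E := E) q)) (a : G) :
    IsHermitianFrame (quotientHermitianStructure hq hJ hg hinv) J (hq a).localInverse.source
      (sectionFrame (hq a).localInverse) where
  isOpen := (hq a).localInverse_open_source
  c2FieldAt _ hx ξ := c2FieldAt_sectionFrame hq hx ξ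
  surjective _ hx := (sectionFrame_bijective hq hx).surjective
  inner_eq _ hx ξ η := sectionFrame_inner hq hginv hx ξ η
  complex _ hx ξ := sectionFrame_complex hq hinv hx ξ
  mlieBracket _ hx ξ η := mlieBracket_sectionFrame hq hx ξ η

end Hermitian

end QuotientFrame

end

theorem theorem1p1 :
    -- Compact quotients of Lie groups with left-invariant Hermitian structure.
    (∀ (E : Type*) [NormedAddCommGroup E] [NormedSpace ℝ E] [FiniteDimensional ℝ E]
      (G : Type*) [TopologicalSpace G] [ChartedSpace E G] [Group G] [LieGroup 𝓘(ℝ, E) ∞ G]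
      (M : Type*) [TopologicalSpace M] [CompactSpace M] [ChartedSpace E M]
      [IsManifold 𝓘(ℝ, E) ∞ M]
      [RiemannianBundle (fun x : M ↦ TangentSpace 𝓘(ℝ, E) x)]
      [IsContMDiffRiemannianBundle 𝓘(ℝ, E) ∞ E (fun x : M ↦ TangentSpace 𝓘(ℝ, E) x)]
      (Γ : Subgroup G) (q : G → M) (J : EndField E M)
      (cov : CovariantDerivative 𝓘(ℝ, E) E (TangentSpace 𝓘(ℝ, E) : M → Type _)) (c : ℝ),
      IsDiscreteQuotientMap (E := E) Γ q →
      IsComplexStructure J →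
      IsHermitianMetric J →
      IsLeftInvariantEnd (liftEnd q J) →
      IsLeftInvariantForm (liftMetric (E := E) q) →
      LieAlgebra.IsSolvable (GroupLieAlgebra 𝓘(ℝ, E) G) →
      HasComplexCommutator (𝔤 := GroupLieAlgebra 𝓘(ℝ, E) G)
        (liftEnd q J 1 : GroupLieAlgebra 𝓘(ℝ, E) G →L[ℝ] GroupLieAlgebra 𝓘(ℝ, E) G) →
      IsChernConnection J cov →
      HasConstantHolSecCurvature J cov c →
      IsFlatConnection cov ∧ (Nontrivial E → c = 0)) ∧
    -- Solvable Hermitian Lie algebras with complex commutator, unimodular or not.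
    (∀ (𝔤 : Type*) [LieRing 𝔤] [LieAlgebra ℝ 𝔤] [FiniteDimensional ℝ 𝔤]
      (h : HermitianStructure 𝔤) (D : 𝔤 →ₗ[ℝ] 𝔤 →ₗ[ℝ] 𝔤) (c : ℝ),
      LieAlgebra.IsSolvable 𝔤 →
      HasComplexCommutator h.J →
      h.IsChern D →
      h.HasConstantHolSec D c →
      (∀ x y z, algCurvature D x y z = 0) ∧ (Nontrivial 𝔤 → c = 0)) := by
  refine ⟨?_, fun 𝔤 _ _ _ h D c hs hJ hD hc ↦ h.flat_and_holSec_eq_zero D c hs hJ hD hc⟩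
  intro E _ _ _ G _ _ _ _ M _ _ _ _ _ _ Γ q J cov c hΓ hJ hg hinv hginv hs hcomm hcov hc
  have hq := hΓ.localDiffeo
  have hfin : FiniteDimensional ℝ (GroupLieAlgebra 𝓘(ℝ, E) G) :=
    inferInstanceAs (FiniteDimensional ℝ E)
  have hF := isHermitianFrame_sectionFrame hq hJ hg hinv hginv
  constructor
  · intro p X Y Z hX hY hZ
    obtain ⟨a, rfl⟩ := hΓ.surjective p
    have hp := (hq a).localInverse_mem_source
    obtain ⟨D, hD, hDF⟩ := (hF a).exists_isChern hcov hp
    have hflat := (quotientHermitianStructure hq hJ hg hinv).flat_and_holSec_eq_zero D c hs hcomm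
      hD ((hF a).hasConstantHolSec hDF hp hc)
    exact (hF a).connectionCurvature_eq_zero hcov hDF hp hflat.1 hX hY hZ
  · intro hE
    have hp := (hq 1).localInverse_mem_source
    obtain ⟨D, hD, hDF⟩ := (hF 1).exists_isChern hcov hp
    exact ((quotientHermitianStructure hq hJ hg hinv).flat_and_holSec_eq_zero D c hs hcomm hD
      ((hF 1).hasConstantHolSec hDF hp hc)).2 hE
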